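/- Let $f=(f_1,\dots,f_n):\mathbb{R}^p\to\mathbb{R}^n$, $y\in\mathbb{R}^n$, $\theta_0\in\mathbb{R}^p$, and let $\mathcal{J}(\theta)=\big(\partial f_i/\partial\theta_j\big)\in\mathbb{R}^{n\times p}$ denote the Jacobian of $f$. Let $\|\cdot\|$ denote the Euclidean norm of vectors and the spectral norm of matrices, and $\sigma_{\min}(A)$ the $n$-th largest singular value of an $n\times p$ matrix $A$ (so that $\sigma_{\min}(A)=\min_{\|u\|=1}\|A^Tu\|$). Let $\alpha>0$, $\nu\ge 3$, let $$\mathcal{D}=\Big\{\theta\in\mathbb{R}^p:\ \|\theta-\theta_0\|\le \nu\,\frac{\|f(\theta_0)-y\|}{\alpha}\Big\},$$ and suppose that $f$ is differentiable at every point of $\mathcal{D}$ and that for all $\theta\in\mathcal{D}$ $$\alpha\le\sigma_{\min}(\mathcal{J}(\theta))\le\|\mathcal{J}(\theta)\|\le\beta\qquad\text{and}\qquad \max_{1\le i\le n}\|\nabla f_i(\theta)\|\le B .$$ Let $\eta\ge 0$ and suppose that one of the following holds: (a) $\|\mathcal{J}(\theta_2)-\mathcal{J}(\theta_1)\|\le\frac{\alpha^2}{2\beta}$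 for all $\theta_1,\theta_2\in\mathcal{D}$, and $\eta\le\frac{\alpha^2}{\nu\beta^2B^2}$; (b) for some $L$, $\|\mathcal{J}(\theta_2)-\mathcal{J}(\theta_1)\|\le L\|\theta_2-\theta_1\|$ for all $\theta_1,\theta_2\in\mathcal{D}$, and $\eta\le\frac{\alpha^2}{\nu\beta^2B^2+\nu\beta BL\|f(\theta_0)-y\|}$. Let $\gamma_0,\gamma_1,\dots$ be i.i.d. random indices, uniform on $\{1,\dots,n\}$, and define the stochastic gradient iterates started at $\theta_0$ by $$\theta_{\tau+1}=\theta_\tau-\eta\,\big(f_{\gamma_\tau}(\theta_\tau)-y_{\gamma_\tau}\big)\nabla f_{\gamma_\tau}(\theta_\tau),\qquad \tau=0,1,2,\dots$$ Then there is an event $E$ with $$\mathbb{P}(E)\ge 1-\frac{4}{\nu}\Big(\frac{\beta}{\alpha}\Big)^{1/p}$$ such that on $E$ all iterates $\theta_\tau$ ($\tau\ge0$) lie in $\mathcal{D}$, and for every $\tau\ge 0$ $$\mathbb{E}\Big[\|f(\theta_\tau)-y\|^2\,\mathbb{1}_E\Big]\le\Big(1-\frac{\eta\alpha^2}{2n}\Big)^{\tau}\|f(\theta_0)-y\|^2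 .$$ (Where $f$ is not differentiable, which can only matter outside $\mathcal{D}$ and hence off $E$, any fixed value of the gradient may be used.) -/

import Mathlib

open MeasureTheory ProbabilityTheory
open scoped Gradient

noncomputable section

/-- `RVec d` is `ℝ^d` with the Euclidean norm. -/
abbrev RVec (d : ℕ) : Type := EuclideanSpace ℝ (Fin d)

/-- The Jacobian of `f : ℝ^p → ℝ^n` at `θ`, as a linear map `ℝ^p → ℝ^n` (its matrix in the standard
bases is `(∂f_i/∂θ_j)`); its operator norm is the spectral norm of that matrix. -/
def jacobian {p n : ℕ} (f : RVec p → RVec n) (θ : RVec p) : RVec p →L[ℝ] RVec n :=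
  fderiv ℝ f θ

/-- The `i`-th row of the Jacobian, i.e. the gradient of the `i`-th component of `f`. -/
def jacobianRow {p n : ℕ} (f : RVec p → RVec n) (i : Fin n) (θ : RVec p) : RVec p :=
  ∇ (fun ϑ => f ϑ i) θ

/-- The minimum (that is, `n`-th largest) singular value of an `n × p` matrix `A`, `n ≤ p`. It is
read off from the transpose, which has the same singular values: it is the square root of the
least eigenvalue of `A Aᵀ`. (For `p < n` this is `0`.) Singular values are indexed from `0`. -/
def sigmaMin {p n : ℕ} (A : RVec p →L[ℝ] RVec n) : ℝ :=
  (ContinuousLinearMap.adjoint A : RVec n →ₗ[ℝ] RVec p).singularValues (n - 1)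

/-- Spectrum of the Jacobian in `[α, β]` over `D` (`f` is differentiable at the points of `D`). -/
def JacobianSpectrum {p n : ℕ} (f : RVec p → RVec n) (D : Set (RVec p)) (α β : ℝ) : Prop :=
  ∀ θ ∈ D, DifferentiableAt ℝ f θ ∧ α ≤ sigmaMin (jacobian f θ) ∧ ‖jacobian f θ‖ ≤ β

/-- Bounded deviation of the Jacobian over `D`, with parameter `lam`. -/
def JacobianBoundedDeviation {p n : ℕ} (f : RVec p → RVec n) (D : Set (RVec p))
    (α β lam : ℝ) : Prop :=
  ∀ θ₁ ∈ D, ∀ θ₂ ∈ D, ‖jacobian f θ₂ - jacobian f θ₁‖ ≤ (1 - lam) * α ^ 2 / β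

/-- Smooth (Lipschitz) deviation of the Jacobian over `D`. -/
def JacobianSmoothDeviation {p n : ℕ} (f : RVec p → RVec n) (D : Set (RVec p)) (L : ℝ) : Prop :=
  ∀ θ₁ ∈ D, ∀ θ₂ ∈ D, ‖jacobian f θ₂ - jacobian f θ₁‖ ≤ L * ‖θ₂ - θ₁‖

/-- The gradient on the `i`-th sample: `(f_i(θ) - y_i) ∇f_i(θ)`. -/
def sampleGradient {p n : ℕ} (f : RVec p → RVec n) (y : RVec n) (θ : RVec p) (i : Fin n) :
    RVec p :=
  (f θ i - y i) • jacobianRow f i θ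

/-- The SGD iterates with step size `η`, started at `θ₀`, for the sequence `g` of sampled indices:
`θ_{τ+1} = θ_τ - η (f_{g τ}(θ_τ) - y_{g τ}) ∇f_{g τ}(θ_τ)`. -/
def sgd {p n : ℕ} (f : RVec p → RVec n) (y : RVec n) (η : ℝ) (θ₀ : RVec p) (g : ℕ → Fin n) :
    ℕ → RVec p
  | 0 => θ₀
  | τ + 1 => sgd f y η θ₀ g τ - η • sampleGradient f y (sgd f y η θ₀ g τ) (g τ)

/-- `γ 0, γ 1, …` are i.i.d. random indices, uniform on the `n` samples. -/
structure IsUniformSampling {Ω : Type*} [MeasurableSpace Ω] (P : Measure Ω) {n : ℕ}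
    (γ : ℕ → Ω → Fin n) : Prop where
  measurable : ∀ τ, Measurable (γ τ)
  indep : iIndepFun γ P
  uniform : ∀ τ i, P.real {ω | γ τ ω = i} = 1 / n

end

/-! Write r = f(θ) − y and F = ‖r‖². A function Φ is sought that drops on average in one step by
(η/n)·d, where d dominates α²Φ, α‖∑ᵢ gᵢ‖√Φ and α²F for the sample gradients gᵢ (`LyapunovDecrease`).
The first bound gives geometric decay at rate 1 − (9/16)ηα²/n.

The other two keep the iterates in D. The displacement splits into a drift, the sum of the mean
steps, and a martingale m, carried as a second coordinate. The drop of √Φ pays for the drift and the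
drop of Φ pays for the variance of m, so `exitPotential` is a supermartingale inside `sgdRegion`. It
is at least R² outside, with R = ν‖f(θ₀) − y‖, and at most (45/4)‖f(θ₀) − y‖² at the start. Markov's
inequality for the stopped chain bounds the exit probability by (45/4)/ν².

Under (b), Φ = F works, as the Jacobian error of a step is quadratic in its length. Under (a) with n
≥ 2 that error is of first order in ‖gᵢ‖, and ∑‖gᵢ‖ is not controlled by ‖∑gᵢ‖. Then Φ(θ) is the
minimum over ϑ ∈ D of ‖A(θ−ϑ) + f(ϑ) − y‖² + K‖θ−ϑ‖² with A = J(θ₀), K = νβ²/4. With the old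
minimizer kept, this is exactly quadratic in θ, and its gradient stays close to 2J(θ)ᵀr
(`lyapunovDecrease_shadow`).

The price is F ≤ (1 + 1/ν)Φ. `exists_event_integral_le` removes this factor: up to a time T by
intersecting with an event of probability at most ν/(ν+1) that depends on later samples only, and
after T because 9/16 > 1/2. The total failure probability is at most 4/ν for ν ≥ 4, and α ≤ β turns
this into the stated bound. -/

/-! ### Functions of finitely many uniform samples -/

section Sampling

variable {Ω : Type*} {n : ℕ} {γ : ℕ → Ω → Fin n}

/-- Finitely many samples take finitely many values, so everything seen by a fixed time factors
through a finite type. Measurability and integrability thus require nothing of f, which is arbitrary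
outside D. -/
theorem IsUniformSampling.exists_factorization {β : Type*} [Nonempty β] (γ : ℕ → Ω → Fin n)
    {S : Finset ℕ} {H : (ℕ → Fin n) → β} (hH : DependsOn H (S : Set ℕ)) :
    ∃ k : (S → Fin n) → β,
      (fun ω => H fun t => γ t ω) = k ∘ fun ω (i : S) => γ i ω := by
  obtain ⟨k, rfl⟩ := dependsOn_iff_exists_comp.1 hH
  exact ⟨k, rfl⟩

variable [MeasurableSpace Ω] {P : Measure Ω}

theorem IsUniformSampling.measurable_of_dependsOn {β : Type*} [Nonempty β] [MeasurableSpace β]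
    (hγ : IsUniformSampling P γ) {S : Finset ℕ} {H : (ℕ → Fin n) → β}
    (hH : DependsOn H (S : Set ℕ)) : Measurable fun ω => H fun t => γ t ω := by
  obtain ⟨k, hk⟩ := IsUniformSampling.exists_factorization γ hH
  rw [hk]
  exact (measurable_of_finite k).comp (measurable_pi_lambda _ fun i => hγ.measurable i)

theorem IsUniformSampling.integrable_of_dependsOn [IsProbabilityMeasure P]
    (hγ : IsUniformSampling P γ) {S : Finset ℕ} {H : (ℕ → Fin n) → ℝ}
    (hH : DependsOn H (S : Set ℕ)) : Integrable (fun ω => H fun t => γ t ω) P := by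
  obtain ⟨k, hk⟩ := IsUniformSampling.exists_factorization γ hH
  rw [hk]
  exact (Integrable.of_finite (f := k)).comp_measurable
    (measurable_pi_lambda _ fun i => hγ.measurable i)

theorem IsUniformSampling.indepFun_of_dependsOn {β β' : Type*} [Nonempty β] [Nonempty β']
    [MeasurableSpace β] [MeasurableSpace β']
    (hγ : IsUniformSampling P γ) {S T : Finset ℕ} (hST : Disjoint S T)
    {H : (ℕ → Fin n) → β} {H' : (ℕ → Fin n) → β'}
    (hH : DependsOn H (S : Set ℕ)) (hH' : DependsOn H' (T : Set ℕ)) :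
    IndepFun (fun ω => H fun t => γ t ω) (fun ω => H' fun t => γ t ω) P := by
  obtain ⟨k, hk⟩ := IsUniformSampling.exists_factorization γ hH
  obtain ⟨k', hk'⟩ := IsUniformSampling.exists_factorization γ hH'
  rw [hk, hk']
  exact (hγ.indep.indepFun_finset S T hST hγ.measurable).comp (measurable_of_finite k)
    (measurable_of_finite k')

/-- Integrating out a sample that is independent of the others. -/
theorem IsUniformSampling.integral_sample [IsProbabilityMeasure P]
    (hγ : IsUniformSampling P γ) {S : Finset ℕ} {τ : ℕ} (hτ : τ ∉ S)
    {H : (ℕ → Fin n) → Fin n → ℝ} (hH : ∀ i, DependsOn (fun g => H g i) (S : Set ℕ)) :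
    ∫ ω, H (fun t => γ t ω) (γ τ ω) ∂P = ∫ ω, (∑ i, H (fun t => γ t ω) i) / n ∂P := by
  have hind : ∀ i, DependsOn (fun g : ℕ → Fin n => if g τ = i then (1 : ℝ) else 0)
      (({τ} : Finset ℕ) : Set ℕ) := fun i x y hxy => by
    have : x τ = y τ := hxy τ (by simp)
    simp [this]
  have hprob : ∀ i, ∫ ω, (if γ τ ω = i then (1 : ℝ) else 0) ∂P = 1 / n := fun i => by
    have hm : MeasurableSet {ω | γ τ ω = i} := hγ.measurable τ (measurableSet_singleton i)
    rw [← hγ.uniform τ i, ← integral_indicator_one hm]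
    refine integral_congr_ae (.of_forall fun ω => ?_)
    simp [Set.indicator_apply]
  have hsplit : ∀ ω, H (fun t => γ t ω) (γ τ ω)
      = ∑ i, H (fun t => γ t ω) i * (if γ τ ω = i then (1 : ℝ) else 0) := fun ω => by simp
  have hmul : ∀ i, ∫ ω, H (fun t => γ t ω) i * (if γ τ ω = i then (1 : ℝ) else 0) ∂P
      = (∫ ω, H (fun t => γ t ω) i ∂P) * (1 / n) := fun i => by
    rw [← hprob i]
    exact (hγ.indepFun_of_dependsOn (by simpa using hτ) (hH i)
      (hind i)).integral_fun_mul_eq_mul_integral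
      (hγ.integrable_of_dependsOn (hH i)).aestronglyMeasurable
      (hγ.integrable_of_dependsOn (hind i)).aestronglyMeasurable
  have hInt : ∀ i, Integrable
      (fun ω => H (fun t => γ t ω) i * (if γ τ ω = i then (1 : ℝ) else 0)) P := fun i =>
    hγ.integrable_of_dependsOn (S := S ∪ {τ})
      (H := fun g => H g i * (if g τ = i then (1 : ℝ) else 0)) fun x y hxy => by
        have h1 := hH i
          (fun t ht => hxy t (by simp [Finset.mem_coe.1 ht]) : ∀ t ∈ (S : Set ℕ), x t = y t)
        have h2 : x τ = y τ := hxy τ (by simp)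
        simp only at h1
        simp [h1, h2]
  simp_rw [hsplit]
  rw [integral_finsetSum _ fun i _ => hInt i]
  simp_rw [hmul]
  rw [integral_div, integral_finsetSum _ fun i _ => hγ.integrable_of_dependsOn (hH i),
    ← Finset.sum_mul]
  ring

/-- Events that depend on later samples only, with any probability of the form `k / n ^ m`. -/
theorem IsUniformSampling.exists_event_of_card [IsProbabilityMeasure P]
    (hγ : IsUniformSampling P γ) (T m k : ℕ) (hk : k ≤ n ^ m) :
    ∃ C : Set (ℕ → Fin n), DependsOn (· ∈ C) ((Finset.Ico T (T + m) : Finset ℕ) : Set ℕ) ∧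
      P.real {ω | (fun t => γ t ω) ∈ C} = k / n ^ m := by
  set S := Finset.Ico T (T + m)
  have hcard : (Finset.univ : Finset (S → Fin n)).card = n ^ m := by
    simp [S]
  obtain ⟨A, -, hA⟩ := Finset.exists_subset_card_eq (s := (Finset.univ : Finset (S → Fin n)))
    (n := k) (by rwa [hcard])
  have hY : Measurable fun ω (i : S) => γ i ω := measurable_pi_lambda _ fun i => hγ.measurable i
  have hpoint : ∀ a : S → Fin n, P.real ((fun ω (i : S) => γ i ω) ⁻¹' {a}) = 1 / n ^ m := by
    intro a
    classical
    have hset : (fun ω (i : S) => γ i ω) ⁻¹' {a}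
        = ⋂ i ∈ S, γ i ⁻¹' (if h : i ∈ S then {a ⟨i, h⟩} else Set.univ) := by
      ext ω
      simp only [Set.mem_preimage, Set.mem_singleton_iff, funext_iff, Subtype.forall,
        Set.mem_iInter]
      refine forall₂_congr fun i hi => ?_
      simp [hi]
    rw [hset, Measure.real, hγ.indep.measure_inter_preimage_eq_mul S fun i _ => by measurability,
      ENNReal.toReal_prod]
    have : ∀ i ∈ S, (P (γ i ⁻¹' (if h : i ∈ S then {a ⟨i, h⟩} else Set.univ))).toReal = 1 / n := by
      intro i hi
      rw [dif_pos hi]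
      exact hγ.uniform i _
    rw [Finset.prod_congr rfl this]
    simp [S]
  refine ⟨{g | (fun i : S => g i) ∈ A}, fun x y hxy => ?_, ?_⟩
  · have : (fun i : S => x i) = fun i : S => y i := funext fun i => hxy i i.2
    simp [this]
  · have : {ω | (fun t => γ t ω) ∈ {g : ℕ → Fin n | (fun i : S => g i) ∈ A}}
        = (fun ω (i : S) => γ i ω) ⁻¹' (A : Set (S → Fin n)) := rfl
    rw [this, ← map_measureReal_apply hY A.measurableSet, ← sum_measureReal_singleton]
    simp_rw [map_measureReal_apply hY (measurableSet_singleton _), hpoint]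
    simp [hA, div_eq_mul_inv]

theorem IsUniformSampling.exists_event_between [IsProbabilityMeasure P]
    (hγ : IsUniformSampling P γ) (hn : 2 ≤ n) (T : ℕ) {lo hi : ℝ} (h0 : 0 ≤ hi) (h1 : hi ≤ 1)
    (hlt : lo < hi) :
    ∃ (m : ℕ) (C : Set (ℕ → Fin n)),
      DependsOn (· ∈ C) ((Finset.Ico T (T + m) : Finset ℕ) : Set ℕ) ∧
      lo ≤ P.real {ω | (fun t => γ t ω) ∈ C} ∧ P.real {ω | (fun t => γ t ω) ∈ C} ≤ hi := by
  have hn' : (1 : ℝ) < n := by exact_mod_cast hn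
  -- The attainable probabilities k / n^m have spacing 1 / n^m, which must fall below hi − lo; this
  -- is where n ≥ 2 enters.
  obtain ⟨m, hm⟩ := pow_unbounded_of_one_lt (1 / (hi - lo)) hn'
  have hpos : (0 : ℝ) < (n : ℝ) ^ m := by positivity
  have hgap : 1 < (n : ℝ) ^ m * (hi - lo) := by
    rwa [div_lt_iff₀ (by linarith)] at hm
  have hk : ⌊hi * (n : ℝ) ^ m⌋₊ ≤ n ^ m := by
    refine Nat.floor_le_of_le ?_
    push_cast
    nlinarith
  obtain ⟨C, hC, hP⟩ := hγ.exists_event_of_card T m _ hk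
  refine ⟨m, C, hC, ?_, ?_⟩
  · rw [hP, le_div_iff₀ hpos]
    have := Nat.lt_floor_add_one (hi * (n : ℝ) ^ m)
    nlinarith
  · rw [hP, div_le_iff₀ hpos]
    exact Nat.floor_le (by positivity)

end Sampling

/-! ### Chains driven by the samples -/

section Chain

variable {S ι : Type*}

/-- The chain with transition `step`, started at `x₀` and driven by the sequence `g`. -/
def drivenChain (step : S → ι → S) (x₀ : S) (g : ℕ → ι) : ℕ → S
  | 0 => x₀
  | τ + 1 => step (drivenChain step x₀ g τ) (g τ)

theorem dependsOn_drivenChain (step : S → ι → S) (x₀ : S) (τ : ℕ) :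
    DependsOn (fun g => drivenChain step x₀ g τ) ((Finset.range τ : Finset ℕ) : Set ℕ) := by
  induction τ with
  | zero => exact fun _ _ _ => rfl
  | succ τ ih =>
    intro g g' h
    have h1 := ih (fun t ht => h t (by simp at ht ⊢; omega) : ∀ t ∈ _, g t = g' t)
    have h2 : g τ = g' τ := h τ (by simp)
    simp only at h1
    simp [drivenChain, h1, h2]

open Classical in
/-- The transition that follows `step` inside `G` and stops outside of `G`. -/
noncomputable def stoppedStep (step : S → ι → S) (G : Set S) (x : S) (i : ι) : S :=
  if x ∈ G then step x i else x

theorem drivenChain_stoppedStep_eq (step : S → ι → S) (G : Set S) (x₀ : S) (g : ℕ → ι) (τ : ℕ)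
    (h : drivenChain (stoppedStep step G) x₀ g τ ∈ G) :
    drivenChain (stoppedStep step G) x₀ g τ = drivenChain step x₀ g τ := by
  induction τ with
  | zero => rfl
  | succ τ ih =>
    by_cases hG : drivenChain (stoppedStep step G) x₀ g τ ∈ G
    · simp [drivenChain, stoppedStep, ih hG, ih hG ▸ hG]
    · simp [drivenChain, stoppedStep, hG] at h

theorem drivenChain_stoppedStep_mem_of_le (step : S → ι → S) (G : Set S) (x₀ : S) (g : ℕ → ι)
    {σ τ : ℕ} (hστ : σ ≤ τ) (h : drivenChain (stoppedStep step G) x₀ g τ ∈ G) :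
    drivenChain (stoppedStep step G) x₀ g σ ∈ G := by
  induction τ, hστ using Nat.le_induction with
  | base => exact h
  | succ τ _ ih =>
    refine ih ?_
    by_contra hG
    simp [drivenChain, stoppedStep, hG] at h

variable {Ω : Type*} {n : ℕ} {γ : ℕ → Ω → Fin n}

/-- The event that a chain never leaves `G`. -/
def stayEvent (step : S → Fin n → S) (x₀ : S) (G : Set S) (γ : ℕ → Ω → Fin n) : Set Ω :=
  {ω | ∀ τ, drivenChain (stoppedStep step G) x₀ (fun t => γ t ω) τ ∈ G}

theorem mem_of_mem_stayEvent {step : S → Fin n → S} {x₀ : S} {G : Set S} {ω : Ω}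
    (h : ω ∈ stayEvent step x₀ G γ) (τ : ℕ) : drivenChain step x₀ (fun t => γ t ω) τ ∈ G := by
  rw [← drivenChain_stoppedStep_eq step G x₀ _ τ (h τ)]
  exact h τ

/-- Never leaving G involves all samples, while being in G at time τ involves only the first τ.
Passing to the latter permits one-step averaging and independence of later samples. -/
theorem indicator_stayEvent_le (step : S → Fin n → S) (x₀ : S) (G : Set S) (F : S → ℝ)
    (hF0 : ∀ x, 0 ≤ F x) (τ : ℕ) (ω : Ω) :
    (stayEvent step x₀ G γ).indicator
      (fun ω => F (drivenChain step x₀ (fun t => γ t ω) τ)) ω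
      ≤ G.indicator F (drivenChain (stoppedStep step G) x₀ (fun t => γ t ω) τ) := by
  by_cases h : ω ∈ stayEvent step x₀ G γ
  · rw [Set.indicator_of_mem h, Set.indicator_of_mem (h τ),
      drivenChain_stoppedStep_eq step G x₀ _ τ (h τ)]
  · rw [Set.indicator_of_notMem h]
    exact Set.indicator_nonneg (fun _ _ => hF0 _) _

variable [MeasurableSpace Ω] {P : Measure Ω}

theorem IsUniformSampling.measurableSet_drivenChain (hγ : IsUniformSampling P γ)
    (step : S → Fin n → S) (x₀ : S) (G : Set S) (τ : ℕ) :
    MeasurableSet {ω | drivenChain step x₀ (fun t => γ t ω) τ ∈ G} :=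
  measurableSet_setOfPred.2 <|
    hγ.measurable_of_dependsOn (H := fun g => drivenChain step x₀ g τ ∈ G)
      fun _ _ h => congrArg (· ∈ G) (dependsOn_drivenChain step x₀ τ h)

theorem IsUniformSampling.measurableSet_stayEvent (hγ : IsUniformSampling P γ)
    (step : S → Fin n → S) (x₀ : S) (G : Set S) : MeasurableSet (stayEvent step x₀ G γ) := by
  rw [stayEvent, Set.ofPred_forall]
  exact MeasurableSet.iInter fun τ => hγ.measurableSet_drivenChain _ x₀ G τ

variable [IsProbabilityMeasure P]

theorem IsUniformSampling.integrable_drivenChain (hγ : IsUniformSampling P γ)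
    (step : S → Fin n → S) (x₀ : S) (V : S → ℝ) (τ : ℕ) :
    Integrable (fun ω => V (drivenChain step x₀ (fun t => γ t ω) τ)) P :=
  hγ.integrable_of_dependsOn (H := fun g => V (drivenChain step x₀ g τ))
    fun _ _ h => congrArg V (dependsOn_drivenChain step x₀ τ h)

theorem IsUniformSampling.integral_drivenChain_le (hγ : IsUniformSampling P γ)
    (step : S → Fin n → S) (x₀ : S) (V : S → ℝ) {c : ℝ} (hc : 0 ≤ c)
    (hV : ∀ x, (∑ i, V (step x i)) / n ≤ c * V x) (τ : ℕ) :
    ∫ ω, V (drivenChain step x₀ (fun t => γ t ω) τ) ∂P ≤ c ^ τ * V x₀ := by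
  induction τ with
  | zero => simp [drivenChain]
  | succ τ ih =>
    calc ∫ ω, V (drivenChain step x₀ (fun t => γ t ω) (τ + 1)) ∂P
        = ∫ ω, (∑ i, V (step (drivenChain step x₀ (fun t => γ t ω) τ) i)) / n ∂P :=
          hγ.integral_sample (S := Finset.range τ)
            (H := fun g i => V (step (drivenChain step x₀ g τ) i)) (by simp)
            fun i _ _ h => congrArg (fun x => V (step x i)) (dependsOn_drivenChain step x₀ τ h)
      _ ≤ ∫ ω, c * V (drivenChain step x₀ (fun t => γ t ω) τ) ∂P :=
          integral_mono
            (hγ.integrable_drivenChain step x₀ (fun x => (∑ i, V (step x i)) / n) τ)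
            ((hγ.integrable_drivenChain step x₀ V τ).const_mul c) fun ω => hV _
      _ ≤ c ^ (τ + 1) * V x₀ := by
          rw [integral_const_mul, pow_succ', mul_assoc]
          exact mul_le_mul_of_nonneg_left ih hc

/-- A nonnegative function that does not increase on average inside `G` and is at least `q` outside
of `G` bounds the probability of leaving `G`. -/
theorem IsUniformSampling.stayEvent_ge (hγ : IsUniformSampling P γ)
    (step : S → Fin n → S) (x₀ : S) (G : Set S) (hn : n ≠ 0) (Q : S → ℝ) {q : ℝ} (hq : 0 < q)
    (hQ0 : ∀ x, 0 ≤ Q x) (hQ : ∀ x ∈ G, (∑ i, Q (step x i)) / n ≤ Q x)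
    (hbad : ∀ x ∉ G, q ≤ Q x) :
    1 - Q x₀ / q ≤ P.real (stayEvent step x₀ G γ) := by
  set X := fun τ ω => drivenChain (stoppedStep step G) x₀ (fun t => γ t ω) τ with hX
  have hn' : (n : ℝ) ≠ 0 := by exact_mod_cast hn
  -- Freezing the chain outside G turns the condition on G into one that holds everywhere.
  have hstep : ∀ x, (∑ i, Q (stoppedStep step G x i)) / n ≤ 1 * Q x := by
    intro x
    by_cases hx : x ∈ G
    · simpa [stoppedStep, hx] using hQ x hx
    · simp [stoppedStep, hx, hn']
  have hfin : ∀ τ, 1 - Q x₀ / q ≤ P.real {ω | X τ ω ∈ G} := by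
    intro τ
    have hmeas := hγ.measurableSet_drivenChain (stoppedStep step G) x₀ G τ
    have hE := hγ.integral_drivenChain_le (stoppedStep step G) x₀ Q zero_le_one hstep τ
    rw [one_pow, one_mul] at hE
    have hmk := mul_meas_ge_le_integral_of_nonneg (μ := P) (f := fun ω => Q (X τ ω))
      (.of_forall fun ω => hQ0 _) (hγ.integrable_drivenChain _ x₀ Q τ) q
    have hsub : P.real {ω | X τ ω ∈ G}ᶜ ≤ P.real {ω | q ≤ Q (X τ ω)} :=
      measureReal_mono fun ω hω => hbad _ hω
    rw [probReal_compl_eq_one_sub hmeas] at hsub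
    have : P.real {ω | q ≤ Q (X τ ω)} ≤ Q x₀ / q := by
      rw [le_div_iff₀ hq]
      linarith
    linarith
  -- A frozen chain cannot return to G, so these events decrease to the event of never leaving, and
  -- the bound passes to the limit.
  have hanti : Antitone fun τ => {ω | X τ ω ∈ G} := fun σ τ hστ ω hω =>
    drivenChain_stoppedStep_mem_of_le step G x₀ _ hστ hω
  have hlim := tendsto_measure_iInter_atTop (μ := P)
    (fun τ => (hγ.measurableSet_drivenChain (stoppedStep step G) x₀ G τ).nullMeasurableSet) hanti
    ⟨0, measure_ne_top _ _⟩
  have hset : stayEvent step x₀ G γ = ⋂ τ, {ω | X τ ω ∈ G} := by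
    rw [stayEvent, Set.ofPred_forall]
  rw [hset]
  exact ge_of_tendsto' ((ENNReal.tendsto_toReal (measure_ne_top _ _)).comp hlim) hfin

/-- Decay of a Lyapunov function on the paths that have not left `G`. -/
theorem IsUniformSampling.integral_indicator_stopped_le (hγ : IsUniformSampling P γ)
    (step : S → Fin n → S) (x₀ : S) (G : Set S) (Φ : S → ℝ) {c : ℝ} (hc : 0 ≤ c)
    (hΦ0 : ∀ x, 0 ≤ Φ x) (hΦ : ∀ x ∈ G, (∑ i, Φ (step x i)) / n ≤ c * Φ x) (τ : ℕ) :
    ∫ ω, G.indicator Φ (drivenChain (stoppedStep step G) x₀ (fun t => γ t ω) τ) ∂P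
      ≤ c ^ τ * Φ x₀ := by
  refine (hγ.integral_drivenChain_le _ x₀ (G.indicator Φ) hc (fun x => ?_) τ).trans
    (mul_le_mul_of_nonneg_left (Set.indicator_le_self' (fun _ _ => hΦ0 _) _) (pow_nonneg hc τ))
  by_cases hx : x ∈ G
  · rw [Set.indicator_of_mem hx]
    refine le_trans ?_ (hΦ x hx)
    gcongr with i
    rw [stoppedStep, if_pos hx]
    exact Set.indicator_le_self' (fun _ _ => hΦ0 _) _
  · simp [stoppedStep, hx]

theorem IsUniformSampling.integrable_indicator_drivenChain (hγ : IsUniformSampling P γ)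
    (step : S → Fin n → S) (x₀ : S) (F : S → ℝ) {E : Set Ω} (hE : MeasurableSet E) (τ : ℕ) :
    Integrable (E.indicator fun ω => F (drivenChain step x₀ (fun t => γ t ω) τ)) P :=
  (hγ.integrable_drivenChain step x₀ F τ).indicator hE

theorem IsUniformSampling.integral_indicator_stayEvent_le (hγ : IsUniformSampling P γ)
    (step : S → Fin n → S) (x₀ : S) (G : Set S) (Φ F : S → ℝ) {c C : ℝ} (hc : 0 ≤ c) (hC : 0 ≤ C)
    (hΦ0 : ∀ x, 0 ≤ Φ x) (hΦ : ∀ x ∈ G, (∑ i, Φ (step x i)) / n ≤ c * Φ x)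
    (hF : ∀ x ∈ G, F x ≤ C * Φ x) (τ : ℕ) :
    ∫ ω, G.indicator F (drivenChain (stoppedStep step G) x₀ (fun t => γ t ω) τ) ∂P
      ≤ C * (c ^ τ * Φ x₀) := by
  calc _ ≤ ∫ ω, C * G.indicator Φ (drivenChain (stoppedStep step G) x₀ (fun t => γ t ω) τ) ∂P := by
        refine integral_mono (hγ.integrable_drivenChain _ x₀ _ τ)
          ((hγ.integrable_drivenChain _ x₀ (G.indicator Φ) τ).const_mul C) fun ω => ?_
        by_cases h : drivenChain (stoppedStep step G) x₀ (fun t => γ t ω) τ ∈ G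
        · simpa [h] using hF _ h
        · simp [h]
    _ ≤ _ := by
        rw [integral_const_mul]
        exact mul_le_mul_of_nonneg_left
          (hγ.integral_indicator_stopped_le step x₀ G Φ hc hΦ0 hΦ τ) hC

/-- If `Φ` decays strictly faster than at the rate `ρ`, then a constant factor `C` between `F` and
`Φ` can be removed at the cost of an event of probability about `1 - 1 / C`. -/
theorem IsUniformSampling.exists_event_integral_le (hγ : IsUniformSampling P γ) (hn : 2 ≤ n)
    (step : S → Fin n → S) (x₀ : S) (G : Set S) (Φ F : S → ℝ) {c C ρ lo hi : ℝ}
    (hc : 0 ≤ c) (hcρ : c < ρ) (hC : 0 ≤ C)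
    (hΦ0 : ∀ x, 0 ≤ Φ x) (hΦ : ∀ x ∈ G, (∑ i, Φ (step x i)) / n ≤ c * Φ x)
    (hF0 : ∀ x, 0 ≤ F x) (hF : ∀ x ∈ G, F x ≤ C * Φ x)
    (h0 : 0 ≤ hi) (h1 : hi ≤ 1) (hlt : lo < hi) (hhi : hi * C ≤ 1) :
    ∃ E : Set Ω, MeasurableSet E ∧ E ⊆ stayEvent step x₀ G γ ∧
      P.real (stayEvent step x₀ G γ) - (1 - lo) ≤ P.real E ∧
      ∀ τ, ∫ ω, E.indicator (fun ω => F (drivenChain step x₀ (fun t => γ t ω) τ)) ω ∂P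
        ≤ ρ ^ τ * Φ x₀ := by
  have hρ : 0 < ρ := hc.trans_lt hcρ
  obtain ⟨T, hT⟩ : ∃ T : ℕ, ∀ τ ≥ T, C * c ^ τ ≤ ρ ^ τ := by
    have hlim : Filter.Tendsto (fun τ : ℕ => C * (c / ρ) ^ τ) Filter.atTop (nhds (C * 0)) :=
      (tendsto_pow_atTop_nhds_zero_of_lt_one (by positivity)
        ((div_lt_one hρ).2 hcρ)).const_mul C
    rw [mul_zero] at hlim
    obtain ⟨T, hT⟩ := Filter.eventually_atTop.1 (hlim.eventually_le_const zero_lt_one)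
    refine ⟨T, fun τ hτ => ?_⟩
    have := hT τ hτ
    rwa [div_pow, ← mul_div_assoc, div_le_one (by positivity)] at this
  obtain ⟨m, A, hA, hlo, hhi'⟩ := hγ.exists_event_between hn T h0 h1 hlt
  set E₀ := stayEvent step x₀ G γ with hE₀
  set A' := {ω | (fun t => γ t ω) ∈ A} with hA'
  have hE₀m := hγ.measurableSet_stayEvent step x₀ G
  have hA'm : MeasurableSet A' := measurableSet_setOfPred.2 <|
    hγ.measurable_of_dependsOn (H := fun g => g ∈ A) hA
  refine ⟨E₀ ∩ A', hE₀m.inter hA'm, Set.inter_subset_left, ?_, fun τ => ?_⟩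
  · have h1 := measureReal_inter_add_sdiff (μ := P) (s := E₀) hA'm
    have h2 : P.real (E₀ \ A') ≤ P.real A'ᶜ := measureReal_mono fun ω h => h.2
    rw [probReal_compl_eq_one_sub hA'm] at h2
    linarith
  set X := fun ω => drivenChain (stoppedStep step G) x₀ (fun t => γ t ω) τ with hX
  have hbound := hγ.integral_indicator_stayEvent_le step x₀ G Φ F hc hC hΦ0 hΦ hF τ
  have hint := hγ.integrable_indicator_drivenChain step x₀ F (hE₀m.inter hA'm) τ
  -- After time T the faster rate c absorbs C. Before it, the state depends on samples before T and
  -- is independent of A, whose probability supplies the factor hi ≤ 1 / C.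
  rcases le_total T τ with hτ | hτ
  · calc _ ≤ ∫ ω, G.indicator F (X ω) ∂P := by
          refine integral_mono hint (hγ.integrable_drivenChain _ x₀ _ τ) fun ω => ?_
          exact (Set.indicator_le_indicator_of_subset Set.inter_subset_left
            (fun _ => hF0 _) ω).trans (indicator_stayEvent_le step x₀ G F hF0 τ ω)
      _ ≤ C * (c ^ τ * Φ x₀) := hbound
      _ = C * c ^ τ * Φ x₀ := by ring
      _ ≤ ρ ^ τ * Φ x₀ := mul_le_mul_of_nonneg_right (hT τ hτ) (hΦ0 x₀)
  · have hdep : DependsOn (fun g : ℕ → Fin n => A.indicator (fun _ => (1 : ℝ)) g)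
        ((Finset.Ico T (T + m) : Finset ℕ) : Set ℕ) := fun g g' h => by
      classical
      have : (g ∈ A) = (g' ∈ A) := hA h
      simp [Set.indicator_apply, this]
    have hdep' : DependsOn
        (fun g : ℕ → Fin n => G.indicator F (drivenChain (stoppedStep step G) x₀ g τ))
        ((Finset.range τ : Finset ℕ) : Set ℕ) :=
      fun _ _ h => congrArg (G.indicator F) (dependsOn_drivenChain _ x₀ τ h)
    have hdisj : Disjoint (Finset.range τ) (Finset.Ico T (T + m)) := by
      rw [Finset.disjoint_left]
      intro a ha hb
      simp at ha hb
      omega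
    have hprod := (hγ.indepFun_of_dependsOn hdisj hdep' hdep).integral_fun_mul_eq_mul_integral
      (hγ.integrable_of_dependsOn hdep').aestronglyMeasurable
      (hγ.integrable_of_dependsOn hdep).aestronglyMeasurable
    have hAint : ∫ ω, A.indicator (fun _ => (1 : ℝ)) (fun t => γ t ω) ∂P = P.real A' := by
      rw [← integral_indicator_one hA'm]
      rfl
    have hGF0 : ∀ x, 0 ≤ G.indicator F x := fun x => Set.indicator_nonneg (fun _ _ => hF0 _) _
    calc _ ≤ ∫ ω, G.indicator F (X ω) * A.indicator (fun _ => (1 : ℝ)) (fun t => γ t ω) ∂P := by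
          refine integral_mono hint ?_ fun ω => ?_
          · refine (hγ.integrable_of_dependsOn (S := Finset.range τ ∪ Finset.Ico T (T + m))
              (H := fun g => G.indicator F (drivenChain (stoppedStep step G) x₀ g τ)
                * A.indicator (fun _ => (1 : ℝ)) g) fun g g' h => ?_)
            exact congrArg₂ (· * ·)
              (hdep' fun t ht => h t (by rw [Finset.coe_union]; exact Or.inl ht))
              (hdep fun t ht => h t (by rw [Finset.coe_union]; exact Or.inr ht))
          · by_cases hω : ω ∈ A'
            · have h2 : A.indicator (fun _ => (1 : ℝ)) (fun t => γ t ω) = 1 :=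
                Set.indicator_of_mem (show (fun t => γ t ω) ∈ A from hω) _
              simp only [h2, mul_one]
              exact (Set.indicator_le_indicator_of_subset Set.inter_subset_left
                (fun _ => hF0 _) ω).trans (indicator_stayEvent_le step x₀ G F hF0 τ ω)
            · rw [Set.indicator_of_notMem fun h => hω h.2]
              exact mul_nonneg (hGF0 _) (Set.indicator_nonneg (fun _ _ => zero_le_one) _)
      _ = (∫ ω, G.indicator F (X ω) ∂P) * P.real A' := by rw [← hAint]; exact hprod
      _ ≤ (C * (c ^ τ * Φ x₀)) * hi :=
          mul_le_mul hbound hhi' measureReal_nonneg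
            (mul_nonneg hC (mul_nonneg (pow_nonneg hc τ) (hΦ0 x₀)))
      _ = hi * C * (c ^ τ * Φ x₀) := by ring
      _ ≤ 1 * (ρ ^ τ * Φ x₀) := by
          refine mul_le_mul hhi ?_ (mul_nonneg (pow_nonneg hc τ) (hΦ0 x₀)) zero_le_one
          exact mul_le_mul_of_nonneg_right (pow_le_pow_left₀ hc hcρ.le τ) (hΦ0 x₀)
      _ = ρ ^ τ * Φ x₀ := one_mul _

end Chain

/-! ### Jacobians and their rows -/

section Jacobian

variable {p n : ℕ}

/-- In an eigenbasis of T*T, ‖Tx‖² is a sum of squared coordinates weighted by eigenvalues, the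
least being the square of the last singular value. -/
theorem LinearMap.singularValues_mul_norm_le {E F : Type*} [NormedAddCommGroup E]
    [InnerProductSpace ℝ E] [FiniteDimensional ℝ E] [NormedAddCommGroup F] [InnerProductSpace ℝ F]
    [FiniteDimensional ℝ F] (T : E →ₗ[ℝ] F) (x : E) :
    T.singularValues (Module.finrank ℝ E - 1) * ‖x‖ ≤ ‖T x‖ := by
  set N := Module.finrank ℝ E with hN
  have hsym := T.isSymmetric_adjoint_comp_self
  set b := hsym.eigenvectorBasis hN.symm
  set s := T.singularValues (N - 1)
  have hs : 0 ≤ s := T.singularValues_nonneg _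
  have hcoef : ∀ i : Fin N, s ^ 2 ≤ hsym.eigenvalues hN.symm i := by
    intro i
    rw [← T.sq_singularValues_fin hN.symm i]
    exact pow_le_pow_left₀ hs (T.singularValues_antitone (by omega)) 2
  have hTx : ‖T x‖ ^ 2 = ∑ i, hsym.eigenvalues hN.symm i * inner ℝ (b i) x ^ 2 := by
    have h1 : ‖T x‖ ^ 2 = inner ℝ ((LinearMap.adjoint T ∘ₗ T) x) x := by
      rw [LinearMap.comp_apply, LinearMap.adjoint_inner_left, real_inner_self_eq_norm_sq]
    rw [h1, ← b.sum_inner_mul_inner]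
    refine Finset.sum_congr rfl fun i _ => ?_
    rw [hsym x (b i), hsym.apply_eigenvectorBasis hN.symm i, inner_smul_right, real_inner_comm]
    simp
    ring
  have hx : ‖x‖ ^ 2 = ∑ i, inner ℝ (b i) x ^ 2 := by
    rw [← b.sum_sq_norm_inner_right x]
    simp
  refine le_of_sq_le_sq ?_ (norm_nonneg _)
  rw [mul_pow, hTx, hx, Finset.mul_sum]
  exact Finset.sum_le_sum fun i _ => mul_le_mul_of_nonneg_right (hcoef i) (sq_nonneg _)

theorem sigmaMin_mul_norm_le (A : RVec p →L[ℝ] RVec n) (w : RVec n) :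
    sigmaMin A * ‖w‖ ≤ ‖ContinuousLinearMap.adjoint A w‖ := by
  have := LinearMap.singularValues_mul_norm_le
    (ContinuousLinearMap.adjoint A : RVec n →ₗ[ℝ] RVec p) w
  simpa [sigmaMin] using this

theorem norm_adjoint_apply_le {A : RVec p →L[ℝ] RVec n} {β : ℝ} (hA : ‖A‖ ≤ β) (w : RVec n) :
    ‖ContinuousLinearMap.adjoint A w‖ ≤ β * ‖w‖ := by
  refine (ContinuousLinearMap.le_opNorm _ w).trans (mul_le_mul_of_nonneg_right ?_ (norm_nonneg w))
  rwa [LinearIsometryEquiv.norm_map]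

theorem jacobianRow_eq_adjoint {f : RVec p → RVec n} {θ : RVec p} (hf : DifferentiableAt ℝ f θ)
    (i : Fin n) :
    jacobianRow f i θ
      = ContinuousLinearMap.adjoint (jacobian f θ) (EuclideanSpace.single i 1) := by
  refine ext_inner_right ℝ fun v => ?_
  rw [ContinuousLinearMap.adjoint_inner_left, EuclideanSpace.inner_single_left, jacobianRow,
    gradient, InnerProductSpace.toDual_symm_apply]
  have h : HasFDerivAt (fun ϑ => f ϑ i) ((EuclideanSpace.proj i).comp (jacobian f θ)) θ :=
    (EuclideanSpace.proj (𝕜 := ℝ) i).hasFDerivAt.comp θ hf.hasFDerivAt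
  rw [h.fderiv]
  simp

theorem sum_sampleGradient {f : RVec p → RVec n} {θ : RVec p} (hf : DifferentiableAt ℝ f θ)
    (y : RVec n) :
    ∑ i, sampleGradient f y θ i = ContinuousLinearMap.adjoint (jacobian f θ) (f θ - y) := by
  have : f θ - y = ∑ i, (f θ i - y i) • EuclideanSpace.single i (1 : ℝ) := by
    ext j
    simp [Finset.sum_apply, Pi.single_apply]
  conv_rhs => rw [this, map_sum]
  refine Finset.sum_congr rfl fun i _ => ?_
  rw [map_smul, ← jacobianRow_eq_adjoint hf i, sampleGradient]

theorem sum_norm_sampleGradient_sq_le {f : RVec p → RVec n} {y : RVec n} {θ : RVec p} {c : ℝ}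
    (hc : ∀ i, ‖jacobianRow f i θ‖ ^ 2 ≤ c) :
    ∑ i, ‖sampleGradient f y θ i‖ ^ 2 ≤ c * ‖f θ - y‖ ^ 2 := by
  rw [EuclideanSpace.norm_sq_eq, Finset.mul_sum]
  refine Finset.sum_le_sum fun i _ => ?_
  rw [sampleGradient, norm_smul, mul_pow, mul_comm]
  exact mul_le_mul_of_nonneg_right (hc i) (sq_nonneg _)

end Jacobian

/-! ### Lyapunov functions for stochastic gradient iterates -/

section Lyapunov

/-- Jensen's inequality: t ↦ (l + b√t)² = l² + 2lb√t + b²t is concave. -/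
theorem avg_sq_add_mul_sqrt_le {n : ℕ} (hn : n ≠ 0) {l b : ℝ} (hl : 0 ≤ l) (hb : 0 ≤ b)
    (φ : Fin n → ℝ) (hφ : ∀ i, 0 ≤ φ i) :
    (∑ i, (l + b * √(φ i)) ^ 2) / n ≤ (l + b * √((∑ i, φ i) / n)) ^ 2 := by
  have hn' : (0 : ℝ) < n := by positivity
  have hsum : 0 ≤ ∑ i, φ i := Finset.sum_nonneg fun i _ => hφ i
  have hmean : (∑ i, √(φ i)) / n ≤ √((∑ i, φ i) / n) := by
    refine Real.le_sqrt_of_sq_le ?_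
    have := sq_sum_le_card_mul_sum_sq (s := Finset.univ) (f := fun i => √(φ i))
    simp only [Real.sq_sqrt (hφ _), Finset.card_univ, Fintype.card_fin] at this
    rw [div_pow, div_le_div_iff₀ (by positivity) hn']
    nlinarith
  have hexp : (∑ i, (l + b * √(φ i)) ^ 2) / n
      = l ^ 2 + 2 * l * b * ((∑ i, √(φ i)) / n) + b ^ 2 * ((∑ i, φ i) / n) := by
    have : ∀ i, (l + b * √(φ i)) ^ 2 = l ^ 2 + 2 * l * b * √(φ i) + b ^ 2 * φ i := fun i => by
      have := Real.sq_sqrt (hφ i)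
      linear_combination b ^ 2 * this
    simp_rw [this, Finset.sum_add_distrib, ← Finset.mul_sum]
    simp
    field_simp
  have hs := Real.sq_sqrt (div_nonneg hsum hn'.le)
  rw [hexp]
  nlinarith [mul_le_mul_of_nonneg_left hmean (mul_nonneg (mul_nonneg zero_le_two hl) hb)]

/-- The tangent bound √(q² − x) ≤ q − x/(2q): a drop x of the square pays for a linear term a. At q
= 0 it gives nothing, hence the separate condition. -/
theorem add_mul_sqrt_le {a b q x s : ℝ} (hb : 0 ≤ b) (hq : 0 ≤ q) (hs : 0 ≤ s)
    (hsx : s ^ 2 ≤ q ^ 2 - x) (hx : 2 * a * q ≤ b * x) (h0 : q = 0 → a ≤ 0) :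
    a + b * s ≤ b * q := by
  rcases hq.eq_or_lt with rfl | hq
  · have : 0 ≤ b * x := by simpa using hx
    have ha := h0 rfl
    rcases hb.eq_or_lt with rfl | hb
    · simpa using ha
    · have : 0 ≤ x := nonneg_of_mul_nonneg_right this hb
      have : s = 0 := by nlinarith
      subst this
      simpa using ha
  · have h1 : 2 * q * s ≤ 2 * q ^ 2 - x := by nlinarith [sq_nonneg (q - s)]
    have h2 : 2 * q * (a + b * s) ≤ 2 * q * (b * q) := by
      nlinarith [mul_le_mul_of_nonneg_left h1 hb]
    exact le_of_mul_le_mul_left h2 (by positivity)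

variable {p n : ℕ}

/-- The average of the sample gradients. -/
noncomputable def meanGradient (f : RVec p → RVec n) (y : RVec n) (θ : RVec p) : RVec p :=
  (n : ℝ)⁻¹ • ∑ i, sampleGradient f y θ i

/-- A stochastic gradient step that also records the accumulated deviation of the sample gradients
from their means. -/
noncomputable def sgdLiftStep (f : RVec p → RVec n) (y : RVec n) (η : ℝ) (x : RVec p × RVec p)
    (i : Fin n) : RVec p × RVec p :=
  (x.1 - η • sampleGradient f y x.1 i,
    x.2 - η • (sampleGradient f y x.1 i - meanGradient f y x.1))

theorem drivenChain_sgdLiftStep_fst (f : RVec p → RVec n) (y : RVec n) (η : ℝ) (θ₀ m₀ : RVec p)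
    (g : ℕ → Fin n) (τ : ℕ) :
    (drivenChain (sgdLiftStep f y η) (θ₀, m₀) g τ).1 = sgd f y η θ₀ g τ := by
  induction τ with
  | zero => rfl
  | succ τ ih => simp only [drivenChain, sgdLiftStep, sgd, ih]

/-- The region in which the drift, the accumulated noise and the Lyapunov function are all
controlled. -/
def sgdRegion (θ₀ : RVec p) (α R : ℝ) (Φ : RVec p → ℝ) : Set (RVec p × RVec p) :=
  {x | α * ‖x.1 - x.2 - θ₀‖ + 11 / 4 * √(Φ x.1) + α * ‖x.2‖ < R}

theorem norm_sub_le_of_mem_sgdRegion {θ₀ : RVec p} {α R : ℝ} (hα : 0 ≤ α) {Φ : RVec p → ℝ}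
    {x : RVec p × RVec p} (hx : x ∈ sgdRegion θ₀ α R Φ) :
    α * ‖x.1 - θ₀‖ + 11 / 4 * √(Φ x.1) < R := by
  have h : x.1 - θ₀ = (x.1 - x.2 - θ₀) + x.2 := by abel
  have h' : ‖x.1 - θ₀‖ ≤ ‖x.1 - x.2 - θ₀‖ + ‖x.2‖ := by
    rw [h]
    exact norm_add_le _ _
  have hx' : α * ‖x.1 - x.2 - θ₀‖ + 11 / 4 * √(Φ x.1) + α * ‖x.2‖ < R := hx
  nlinarith [mul_le_mul_of_nonneg_left h' hα]

/-- The one-step conditions on a Lyapunov function `Φ` of the stochastic gradient iterates at `θ`: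
it decreases on average by an amount that dominates `Φ`, the drift and the residual. -/
def LyapunovDecrease (f : RVec p → RVec n) (y : RVec n) (η α : ℝ) (Φ : RVec p → ℝ)
    (θ : RVec p) : Prop :=
  ∃ d : ℝ, (∑ i, Φ (θ - η • sampleGradient f y θ i)) / n ≤ Φ θ - η / n * d ∧
    9 / 16 * α ^ 2 * Φ θ ≤ d ∧
    8 / 11 * α * ‖∑ i, sampleGradient f y θ i‖ * √(Φ θ) ≤ d ∧
    5 / 7 * α ^ 2 * ‖f θ - y‖ ^ 2 ≤ d

/-- The function that controls the probability of leaving `sgdRegion`. -/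
noncomputable def exitPotential (θ₀ : RVec p) (α : ℝ) (Φ : RVec p → ℝ) (x : RVec p × RVec p) : ℝ :=
  5 / 4 * (α * ‖x.1 - x.2 - θ₀‖ + 11 / 4 * √(Φ x.1)) ^ 2 +
    5 * (α ^ 2 * ‖x.2‖ ^ 2 + 7 / 20 * Φ x.1)

/-- The weights 5/4 and 5 come from (a + b)² ≤ (5/4)a² + 5b², as 4/5 + 1/5 = 1. -/
theorem sq_le_exitPotential {θ₀ : RVec p} {α R : ℝ} (hR : 0 ≤ R) {Φ : RVec p → ℝ}
    (hΦ0 : ∀ θ, 0 ≤ Φ θ) {x : RVec p × RVec p} (hx : x ∉ sgdRegion θ₀ α R Φ) :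
    R ^ 2 ≤ exitPotential θ₀ α Φ x := by
  have hx' : R ≤ α * ‖x.1 - x.2 - θ₀‖ + 11 / 4 * √(Φ x.1) + α * ‖x.2‖ := not_lt.1 hx
  have h := hΦ0 x.1
  rw [exitPotential]
  set a := α * ‖x.1 - x.2 - θ₀‖ + 11 / 4 * √(Φ x.1)
  nlinarith [sq_nonneg (a - 4 * (α * ‖x.2‖)), pow_le_pow_left₀ hR hx' 2]

/-- The cross term with m vanishes because the increments are centred, and a variance is at most a
second moment. -/
theorem avg_norm_sub_smul_sub_mean_sq_le (hn : n ≠ 0) (g : Fin n → RVec p) (m : RVec p) (η : ℝ) :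
    (∑ i, ‖m - η • (g i - (n : ℝ)⁻¹ • ∑ j, g j)‖ ^ 2) / n
      ≤ ‖m‖ ^ 2 + η ^ 2 / n * ∑ i, ‖g i‖ ^ 2 := by
  have hn' : (0 : ℝ) < n := by positivity
  set G := (n : ℝ)⁻¹ • ∑ j, g j with hG
  have hsum : ∑ i, g i = (n : ℝ) • G := by
    rw [hG, smul_smul, mul_inv_cancel₀ hn'.ne', one_smul]
  have hexp : ∀ i, ‖m - η • (g i - G)‖ ^ 2 = ‖m‖ ^ 2 - 2 * η * inner ℝ m (g i)
      + 2 * η * inner ℝ m G + η ^ 2 * (‖g i‖ ^ 2 - 2 * inner ℝ (g i) G + ‖G‖ ^ 2) := fun i => by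
    rw [norm_sub_sq_real, norm_smul, mul_pow, norm_sub_sq_real, inner_smul_right, inner_sub_right]
    simp only [Real.norm_eq_abs, sq_abs]
    ring
  have h1 : ∑ i, inner ℝ m (g i) = n * inner ℝ m G := by
    rw [← inner_sum, hsum, inner_smul_right]
  have h2 : ∑ i, inner ℝ (g i) G = n * ‖G‖ ^ 2 := by
    rw [← sum_inner, hsum, real_inner_smul_left, real_inner_self_eq_norm_sq]
  simp_rw [hexp, Finset.sum_add_distrib, Finset.sum_sub_distrib, ← Finset.mul_sum,
    Finset.sum_add_distrib, Finset.sum_sub_distrib, ← Finset.mul_sum, h1, h2]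
  simp only [Finset.sum_const, Finset.card_univ, Fintype.card_fin, nsmul_eq_mul]
  rw [div_le_iff₀ hn']
  have : (‖m‖ ^ 2 + η ^ 2 / n * ∑ i, ‖g i‖ ^ 2) * n = n * ‖m‖ ^ 2 + η ^ 2 * ∑ i, ‖g i‖ ^ 2 := by
    field_simp
  rw [this]
  nlinarith [mul_nonneg (sq_nonneg η) (mul_nonneg hn'.le (sq_nonneg ‖G‖))]

/-- Each summand of the potential is a supermartingale by itself: √Φ offsets the drift in the first,
Φ offsets the noise in the second. -/
theorem avg_exitPotential_le (hn : n ≠ 0) {f : RVec p → RVec n} {y : RVec n} {η α : ℝ}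
    (hη : 0 < η) (hα : 0 < α) {θ₀ : RVec p} {Φ : RVec p → ℝ} (hΦ0 : ∀ θ, 0 ≤ Φ θ)
    {x : RVec p × RVec p}
    (hvar : η * ∑ i, ‖sampleGradient f y x.1 i‖ ^ 2 ≤ ‖f x.1 - y‖ ^ 2 / 4)
    (hdec : LyapunovDecrease f y η α Φ x.1) :
    (∑ i, exitPotential θ₀ α Φ (sgdLiftStep f y η x i)) / n ≤ exitPotential θ₀ α Φ x := by
  obtain ⟨θ, m⟩ := x
  obtain ⟨d, hd, -, hd2, hd3⟩ := hdec
  simp only at hvar hd hd2 hd3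
  have hn' : (0 : ℝ) < n := by positivity
  set g := sampleGradient f y θ with hg
  set s := (∑ i, Φ (θ - η • g i)) / n with hs
  have hs0 : 0 ≤ s := div_nonneg (Finset.sum_nonneg fun i _ => hΦ0 _) hn'.le
  set l := α * ‖θ - m - η • meanGradient f y θ - θ₀‖ with hl
  have hl0 : 0 ≤ l := by positivity
  have hpot : ∀ i, exitPotential θ₀ α Φ (sgdLiftStep f y η (θ, m) i)
      = 5 / 4 * (l + 11 / 4 * √(Φ (θ - η • g i))) ^ 2 +
        5 * (α ^ 2 * ‖m - η • (g i - (n : ℝ)⁻¹ • ∑ j, g j)‖ ^ 2 + 7 / 20 * Φ (θ - η • g i)) := by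
    intro i
    have : θ - η • g i - (m - η • (g i - meanGradient f y θ)) - θ₀
        = θ - m - η • meanGradient f y θ - θ₀ := by
      rw [smul_sub]
      abel
    simp only [exitPotential, sgdLiftStep]
    rw [← hg, this]
    rfl
  have hdrift : ‖η • meanGradient f y θ‖ = η / n * ‖∑ i, g i‖ := by
    rw [meanGradient, norm_smul, norm_smul, Real.norm_of_nonneg hη.le, norm_inv,
      Real.norm_of_nonneg hn'.le]
    ring
  have hl1 : l ≤ α * ‖θ - m - θ₀‖ + α * (η / n * ‖∑ i, g i‖) := by
    have h1 : θ - m - η • meanGradient f y θ - θ₀ = (θ - m - θ₀) - η • meanGradient f y θ := by abel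
    rw [hl, h1, ← hdrift, ← mul_add]
    exact mul_le_mul_of_nonneg_left (norm_sub_le _ _) hα.le
  have hkey : α * (η / n * ‖∑ i, g i‖) + 11 / 4 * √s ≤ 11 / 4 * √(Φ θ) := by
    refine add_mul_sqrt_le (x := η / n * d) (by norm_num) (Real.sqrt_nonneg _)
      (Real.sqrt_nonneg _) ?_ ?_ fun h0 => ?_
    · rw [Real.sq_sqrt hs0, Real.sq_sqrt (hΦ0 θ)]
      exact hd
    · have := mul_le_mul_of_nonneg_left hd2 (div_pos hη hn').le
      linarith
    -- If Φ(θ) = 0 there is no room to decrease, so d ≤ 0. The residual is then zero and all sample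
    -- gradients vanish.
    · rw [Real.sqrt_eq_zero (hΦ0 θ)] at h0
      have h1 : η / n * d ≤ 0 := by linarith
      have h2 : d ≤ 0 := nonpos_of_mul_nonpos_right h1 (div_pos hη hn')
      have h3 : ‖f θ - y‖ ^ 2 ≤ 0 := by
        refine nonpos_of_mul_nonpos_right (hd3.trans h2) (by positivity)
      have h4 : f θ - y = 0 := by
        rw [← norm_eq_zero]
        exact pow_eq_zero_iff two_ne_zero |>.1 (le_antisymm h3 (sq_nonneg _))
      have h5 : ∀ i, g i = 0 := fun i => by
        have : f θ i - y i = 0 := congrArg (fun v : RVec n => v i) h4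
        rw [hg, sampleGradient, this, zero_smul]
      simp [h5]
  have hA := avg_sq_add_mul_sqrt_le hn hl0 (b := 11 / 4) (by norm_num)
    (fun i => Φ (θ - η • g i)) fun i => hΦ0 _
  have hB := avg_norm_sub_smul_sub_mean_sq_le hn g m η
  have hA' : (l + 11 / 4 * √s) ^ 2 ≤ (α * ‖θ - m - θ₀‖ + 11 / 4 * √(Φ θ)) ^ 2 := by
    refine pow_le_pow_left₀ (by positivity) ?_ 2
    linarith
  -- Here 7/20 = (1/4)·(7/5), from the variance bound F/4 and α²F ≤ (7/5)d.
  have hV : α ^ 2 * (η ^ 2 / n * ∑ i, ‖g i‖ ^ 2) ≤ 7 / 20 * (η / n * d) := by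
    have h1 : η ^ 2 / n * ∑ i, ‖g i‖ ^ 2 = η / n * (η * ∑ i, ‖g i‖ ^ 2) := by ring
    have h2 : α ^ 2 * (η * ∑ i, ‖g i‖ ^ 2) ≤ 7 / 20 * d := by
      nlinarith [mul_le_mul_of_nonneg_left hvar (sq_nonneg α)]
    rw [h1]
    have := mul_le_mul_of_nonneg_left h2 (div_pos hη hn').le
    linarith
  have hsplit : (∑ i, exitPotential θ₀ α Φ (sgdLiftStep f y η (θ, m) i)) / n
      = 5 / 4 * ((∑ i, (l + 11 / 4 * √(Φ (θ - η • g i))) ^ 2) / n) +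
        5 * (α ^ 2 * ((∑ i, ‖m - η • (g i - (n : ℝ)⁻¹ • ∑ j, g j)‖ ^ 2) / n) + 7 / 20 * s) := by
    simp_rw [hpot, Finset.sum_add_distrib, ← Finset.mul_sum, Finset.sum_add_distrib,
      ← Finset.mul_sum, hs]
    ring
  rw [hsplit]
  simp only [exitPotential]
  nlinarith [mul_le_mul_of_nonneg_left hB (sq_nonneg α)]

variable {Ω : Type*} [MeasurableSpace Ω] {P : Measure Ω} [IsProbabilityMeasure P]
  {γ : ℕ → Ω → Fin n}

theorem IsUniformSampling.stayEvent_sgdRegion_ge (hγ : IsUniformSampling P γ) (hn : n ≠ 0)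
    {f : RVec p → RVec n} {y : RVec n} {η α ν : ℝ}
    (hη : 0 < η) (hα : 0 < α) (hν : 0 < ν) {θ₀ : RVec p} (h0 : 0 < ‖f θ₀ - y‖)
    {Φ : RVec p → ℝ} (hΦ0 : ∀ θ, 0 ≤ Φ θ) (hΦi : Φ θ₀ ≤ ‖f θ₀ - y‖ ^ 2)
    (hvar : ∀ θ, α * ‖θ - θ₀‖ ≤ ν * ‖f θ₀ - y‖ →
      η * ∑ i, ‖sampleGradient f y θ i‖ ^ 2 ≤ ‖f θ - y‖ ^ 2 / 4)
    (hdec : ∀ θ, α * ‖θ - θ₀‖ + 11 / 4 * √(Φ θ) < ν * ‖f θ₀ - y‖ →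
      LyapunovDecrease f y η α Φ θ) :
    1 - 45 / 4 / ν ^ 2 ≤
      P.real (stayEvent (sgdLiftStep f y η) (θ₀, 0) (sgdRegion θ₀ α (ν * ‖f θ₀ - y‖) Φ) γ) := by
  set R := ν * ‖f θ₀ - y‖ with hR
  have hR0 : 0 < R := by positivity
  have h := hγ.stayEvent_ge (sgdLiftStep f y η) (θ₀, 0) (sgdRegion θ₀ α R Φ) hn
    (exitPotential θ₀ α Φ) (q := R ^ 2) (by positivity)
    (fun x => by have := hΦ0 x.1; rw [exitPotential]; positivity)
    (fun x hx => ?_) (fun x hx => sq_le_exitPotential hR0.le hΦ0 hx)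
  · refine le_trans (sub_le_sub_left ?_ 1) h
    rw [div_le_div_iff₀ (by positivity) (by positivity)]
    -- The initial coefficient is (5/4)(11/4)² + 7/4 = 717/64 < 45/4.
    have h1 : exitPotential θ₀ α Φ (θ₀, 0) ≤ 45 / 4 * ‖f θ₀ - y‖ ^ 2 := by
      simp only [exitPotential, sub_zero, sub_self, norm_zero, mul_zero, zero_add]
      rw [mul_pow, Real.sq_sqrt (hΦ0 θ₀)]
      linarith [sq_nonneg ‖f θ₀ - y‖]
    rw [hR, mul_pow]
    nlinarith [mul_le_mul_of_nonneg_right h1 (sq_nonneg ν)]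
  · have hx' := norm_sub_le_of_mem_sgdRegion hα.le hx
    have := Real.sqrt_nonneg (Φ x.1)
    exact avg_exitPotential_le hn hη hα hΦ0 (hvar x.1 (by linarith)) (hdec x.1 hx')

theorem avg_lyapunov_le (hn : n ≠ 0) {f : RVec p → RVec n} {y : RVec n} {η α : ℝ} (hη : 0 < η)
    {Φ : RVec p → ℝ} {x : RVec p × RVec p} (hdec : LyapunovDecrease f y η α Φ x.1) :
    (∑ i, Φ (sgdLiftStep f y η x i).1) / n ≤ (1 - 9 / 16 * (η * α ^ 2 / n)) * Φ x.1 := by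
  obtain ⟨d, hd, hd1, -, -⟩ := hdec
  have hn' : (0 : ℝ) < n := by positivity
  refine hd.trans ?_
  have := mul_le_mul_of_nonneg_left hd1 (div_pos hη hn').le
  have h2 : η / n * (9 / 16 * α ^ 2 * Φ x.1) = 9 / 16 * (η * α ^ 2 / n) * Φ x.1 := by ring
  linarith

end Lyapunov

/-! ### One-step decrease of the squared residual and of its regularization -/

section Decrease

variable {p n : ℕ}

theorem inner_residual_sum_sampleGradient {f : RVec p → RVec n} {θ : RVec p}
    (hf : DifferentiableAt ℝ f θ) (y : RVec n) :
    ∑ i, inner ℝ (f θ - y) (jacobian f θ (sampleGradient f y θ i))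
      = ‖ContinuousLinearMap.adjoint (jacobian f θ) (f θ - y)‖ ^ 2 := by
  rw [← inner_sum, ← map_sum, sum_sampleGradient hf, ← ContinuousLinearMap.adjoint_inner_left,
    real_inner_self_eq_norm_sq]

/-- The squared residual on `D`, extended by zero. -/
noncomputable def residualSqOn (f : RVec p → RVec n) (y : RVec n) (D : Set (RVec p)) :
    RVec p → ℝ :=
  D.indicator fun θ => ‖f θ - y‖ ^ 2

theorem residualSqOn_nonneg (f : RVec p → RVec n) (y : RVec n) (D : Set (RVec p)) (θ : RVec p) :
    0 ≤ residualSqOn f y D θ :=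
  Set.indicator_nonneg (fun _ _ => sq_nonneg _) θ

theorem residualSqOn_of_mem {f : RVec p → RVec n} {y : RVec n} {D : Set (RVec p)} {θ : RVec p}
    (h : θ ∈ D) : residualSqOn f y D θ = ‖f θ - y‖ ^ 2 :=
  Set.indicator_of_mem h _

theorem residualSqOn_le {f : RVec p → RVec n} {y : RVec n} {D : Set (RVec p)} {θ : RVec p} {e : ℝ}
    (he : 0 ≤ e) (h : θ ∈ D → ‖f θ - y‖ ^ 2 ≤ e) : residualSqOn f y D θ ≤ e := by
  by_cases hθ : θ ∈ D
  · rw [residualSqOn_of_mem hθ]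
    exact h hθ
  · rw [residualSqOn, Set.indicator_of_notMem hθ]
    exact he

/-- A step of size `η` along a direction `g`, for a Jacobian that deviates by at most `κ`. -/
theorem norm_residual_step_sq_le {f : RVec p → RVec n} {y : RVec n} {D : Set (RVec p)}
    (hD : Convex ℝ D) {β κ η : ℝ} {θ g : RVec p}
    (hf : ∀ ϑ ∈ D, DifferentiableAt ℝ f ϑ) (hβ : ∀ ϑ ∈ D, ‖jacobian f ϑ‖ ≤ β)
    (hη : 0 ≤ η) (hθ : θ ∈ D) (hθ' : θ - η • g ∈ D)
    (hκ : ∀ ϑ ∈ segment ℝ θ (θ - η • g), ‖jacobian f ϑ - jacobian f θ‖ ≤ κ) :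
    ‖f (θ - η • g) - y‖ ^ 2 ≤ ‖f θ - y‖ ^ 2 - 2 * η * inner ℝ (f θ - y) (jacobian f θ g)
      + 2 * η * κ * ‖f θ - y‖ * ‖g‖ + η ^ 2 * β ^ 2 * ‖g‖ ^ 2 := by
  have hseg : segment ℝ θ (θ - η • g) ⊆ D := hD.segment_subset hθ hθ'
  have hnorm : ‖θ - η • g - θ‖ = η * ‖g‖ := by
    rw [sub_sub_cancel_left, norm_neg, norm_smul, Real.norm_of_nonneg hη]
  have h1 := hD.norm_image_sub_le_of_norm_fderiv_le hf hβ hθ hθ'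
  have h2 := (convex_segment (𝕜 := ℝ) θ (θ - η • g)).norm_image_sub_le_of_norm_fderiv_le'
    (fun ϑ h => hf ϑ (hseg h)) hκ (left_mem_segment ℝ _ _) (right_mem_segment ℝ _ _)
  rw [hnorm] at h1 h2
  set v := f (θ - η • g) - f θ with hv
  have h3 : θ - η • g - θ = -(η • g) := by abel
  rw [h3, map_neg, map_smul, sub_neg_eq_add] at h2
  have h4 : f (θ - η • g) - y = (f θ - y) + v := by rw [hv]; abel
  have h5 : inner ℝ (f θ - y) v
      = inner ℝ (f θ - y) (v + η • jacobian f θ g) - η * inner ℝ (f θ - y) (jacobian f θ g) := by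
    rw [inner_add_right, inner_smul_right]
    ring
  have h6 : inner ℝ (f θ - y) (v + η • jacobian f θ g) ≤ ‖f θ - y‖ * (κ * (η * ‖g‖)) :=
    (real_inner_le_norm _ _).trans (mul_le_mul_of_nonneg_left h2 (norm_nonneg _))
  have h7 : ‖v‖ ^ 2 ≤ (β * (η * ‖g‖)) ^ 2 := pow_le_pow_left₀ (norm_nonneg _) h1 2
  rw [h4, norm_add_sq_real, h5]
  nlinarith

/-- Along a step of length η‖gᵢ‖ the Jacobian moves by at most Lη‖gᵢ‖. The error is therefore of
order η²‖gᵢ‖², and ∑‖gᵢ‖² is a multiple of F. -/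
theorem lyapunovDecrease_of_smooth {f : RVec p → RVec n} {y : RVec n} {D : Set (RVec p)}
    (hn : n ≠ 0) (hD : Convex ℝ D) {α β B L η : ℝ} (hα : 0 < α) (hβ0 : 0 < β) (hL : 0 ≤ L)
    (hη : 0 ≤ η)
    (hf : ∀ ϑ ∈ D, DifferentiableAt ℝ f ϑ) (hβ : ∀ ϑ ∈ D, ‖jacobian f ϑ‖ ≤ β)
    (hlow : ∀ ϑ ∈ D, ∀ w, α * ‖w‖ ≤ ‖ContinuousLinearMap.adjoint (jacobian f ϑ) w‖)
    (hrow : ∀ θ ∈ D, ∀ i, ‖jacobianRow f i θ‖ ≤ B)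
    (hdev : JacobianSmoothDeviation f D L) {θ : RVec p} (hθ : θ ∈ D)
    (hsmall : η * (2 * L * (β * B) * ‖f θ - y‖ + β ^ 2 * B ^ 2) ≤ 8 / 11 * α ^ 2) :
    LyapunovDecrease f y η α (residualSqOn f y D) θ := by
  have hn' : (0 : ℝ) < n := by positivity
  set F := ‖f θ - y‖ ^ 2 with hF
  set g := sampleGradient f y θ with hg
  set T := ‖ContinuousLinearMap.adjoint (jacobian f θ) (f θ - y)‖ with hT
  have hTF : α * ‖f θ - y‖ ≤ T := hlow θ hθ _
  have hTF2 : α ^ 2 * F ≤ T ^ 2 := by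
    rw [hF, ← mul_pow]
    exact pow_le_pow_left₀ (by positivity) hTF 2
  set e := fun i => F - 2 * η * inner ℝ (f θ - y) (jacobian f θ (g i))
    + (2 * η ^ 2 * L * ‖f θ - y‖ + η ^ 2 * β ^ 2) * ‖g i‖ ^ 2 with he
  -- A step may leave D, where Φ is set to zero, so the bound itself must be nonnegative; it
  -- dominates ‖r − ηJgᵢ‖².
  have he0 : ∀ i, 0 ≤ e i := fun i => by
    have h1 : ‖jacobian f θ (g i)‖ ≤ β * ‖g i‖ :=
      (ContinuousLinearMap.le_opNorm _ _).trans
        (mul_le_mul_of_nonneg_right (hβ θ hθ) (norm_nonneg _))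
    have h2 := pow_le_pow_left₀ (norm_nonneg _) h1 2
    have h3 : 0 ≤ ‖(f θ - y) - η • jacobian f θ (g i)‖ ^ 2 := sq_nonneg _
    rw [norm_sub_sq_real, norm_smul, inner_smul_right, mul_pow, Real.norm_eq_abs, sq_abs] at h3
    have h4 := mul_le_mul_of_nonneg_left h2 (sq_nonneg η)
    have h5 : 0 ≤ 2 * η ^ 2 * L * ‖f θ - y‖ * ‖g i‖ ^ 2 := by positivity
    simp only [he]
    nlinarith
  have hstep : ∀ i, residualSqOn f y D (θ - η • g i) ≤ e i := fun i =>
    residualSqOn_le (he0 i) fun hi => by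
      have h := norm_residual_step_sq_le (y := y) (κ := L * (η * ‖g i‖)) hD hf hβ hη hθ hi
        fun ϑ hϑ => ?_
      · refine h.trans (le_of_eq ?_)
        simp only [he]
        ring
      · refine (hdev θ hθ ϑ (hD.segment_subset hθ hi hϑ)).trans
          (mul_le_mul_of_nonneg_left ?_ hL)
        have h1 := norm_sub_le_of_mem_segment hϑ
        rwa [sub_sub_cancel_left, norm_neg, norm_smul, Real.norm_of_nonneg hη] at h1
  have hrowβ : ∀ i, ‖jacobianRow f i θ‖ ≤ β := fun i => by
    rw [jacobianRow_eq_adjoint (hf θ hθ)]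
    simpa using norm_adjoint_apply_le (hβ θ hθ) (EuclideanSpace.single i (1 : ℝ))
  -- One factor of the squared row norm is bounded by β and the other by B, which matches the
  -- product βBL in the step-size condition.
  have hg1 : ∑ i, ‖g i‖ ^ 2 ≤ β * B * F := sum_norm_sampleGradient_sq_le fun i => by
    rw [sq]
    exact mul_le_mul (hrowβ i) (hrow θ hθ i) (norm_nonneg _) hβ0.le
  have hg2 : ∑ i, ‖g i‖ ^ 2 ≤ B ^ 2 * F := sum_norm_sampleGradient_sq_le fun i =>
    pow_le_pow_left₀ (norm_nonneg _) (hrow θ hθ i) 2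
  have hsum : ∑ i, e i = n * F - 2 * η * T ^ 2
      + (2 * η ^ 2 * L * ‖f θ - y‖ + η ^ 2 * β ^ 2) * ∑ i, ‖g i‖ ^ 2 := by
    simp only [he, Finset.sum_add_distrib, Finset.sum_sub_distrib, ← Finset.mul_sum]
    rw [inner_residual_sum_sampleGradient (hf θ hθ)]
    simp [hT]
  have hsum' : ∑ i, e i ≤ n * F - η * (2 * T ^ 2 - 8 / 11 * α ^ 2 * F) := by
    have h1 : 2 * η ^ 2 * L * ‖f θ - y‖ * ∑ i, ‖g i‖ ^ 2
        ≤ 2 * η ^ 2 * L * ‖f θ - y‖ * (β * B * F) :=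
      mul_le_mul_of_nonneg_left hg1 (by positivity)
    have h2 : η ^ 2 * β ^ 2 * ∑ i, ‖g i‖ ^ 2 ≤ η ^ 2 * β ^ 2 * (B ^ 2 * F) :=
      mul_le_mul_of_nonneg_left hg2 (by positivity)
    have h3 := mul_le_mul_of_nonneg_right hsmall (mul_nonneg hη (sq_nonneg ‖f θ - y‖))
    rw [hsum]
    nlinarith
  refine ⟨2 * T ^ 2 - 8 / 11 * α ^ 2 * F, ?_, ?_, ?_, ?_⟩
  · rw [residualSqOn_of_mem hθ, div_le_iff₀ hn']
    refine (Finset.sum_le_sum fun i _ => hstep i).trans (hsum'.trans (le_of_eq ?_))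
    rw [← hF]
    field_simp
  · rw [residualSqOn_of_mem hθ]
    nlinarith
  · rw [residualSqOn_of_mem hθ, Real.sqrt_sq (norm_nonneg _), sum_sampleGradient (hf θ hθ), ← hT]
    nlinarith [mul_le_mul_of_nonneg_left hTF (norm_nonneg
      (ContinuousLinearMap.adjoint (jacobian f θ) (f θ - y)))]
  · nlinarith

/-- A single sample gradient is the full gradient Jᵀr. With T = ‖Jᵀr‖, the first-order error is then
at most half of the main term: (α²/(2β))‖r‖T ≤ T²/2. -/
theorem lyapunovDecrease_of_one_sample {f : RVec p → RVec 1} {y : RVec 1} {D : Set (RVec p)}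
    (hD : Convex ℝ D) {α β η : ℝ} (hα : 0 < α) (hαβ : α ≤ β) (hη : 0 ≤ η)
    (hf : ∀ ϑ ∈ D, DifferentiableAt ℝ f ϑ) (hβ : ∀ ϑ ∈ D, ‖jacobian f ϑ‖ ≤ β)
    (hlow : ∀ ϑ ∈ D, ∀ w, α * ‖w‖ ≤ ‖ContinuousLinearMap.adjoint (jacobian f ϑ) w‖)
    (hdev : JacobianBoundedDeviation f D α β (1 / 2)) {θ : RVec p} (hθ : θ ∈ D)
    (hsmall : η * β ^ 2 ≤ 1 / 4) :
    LyapunovDecrease f y η α (residualSqOn f y D) θ := by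
  have hβ0 : 0 < β := hα.trans_le hαβ
  set F := ‖f θ - y‖ ^ 2 with hF
  set g := sampleGradient f y θ with hg
  set T := ‖ContinuousLinearMap.adjoint (jacobian f θ) (f θ - y)‖ with hT
  have hgJ : g 0 = ContinuousLinearMap.adjoint (jacobian f θ) (f θ - y) := by
    rw [← sum_sampleGradient (hf θ hθ), Fin.sum_univ_one]
  have hinner : inner ℝ (f θ - y) (jacobian f θ (g 0)) = T ^ 2 := by
    have := inner_residual_sum_sampleGradient (hf θ hθ) y
    rwa [Fin.sum_univ_one] at this
  have hTF : α * ‖f θ - y‖ ≤ T := hlow θ hθ _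
  have hTF2 : α ^ 2 * F ≤ T ^ 2 := by
    rw [hF, ← mul_pow]
    exact pow_le_pow_left₀ (by positivity) hTF 2
  have hTβ : T ^ 2 ≤ β ^ 2 * F := by
    rw [hF, ← mul_pow]
    exact pow_le_pow_left₀ (norm_nonneg _) (norm_adjoint_apply_le (hβ θ hθ) _) 2
  have hηT : η * T ^ 2 ≤ F / 4 := by
    nlinarith [mul_le_mul_of_nonneg_left hTβ hη,
      mul_le_mul_of_nonneg_right hsmall (sq_nonneg ‖f θ - y‖)]
  have hF0 : 0 ≤ F := sq_nonneg _
  have hle : residualSqOn f y D (θ - η • g 0) ≤ F - η * (3 / 4 * T ^ 2) :=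
    residualSqOn_le (by linarith) fun hi => by
      have h := norm_residual_step_sq_le (y := y) (κ := (1 - 1 / 2) * α ^ 2 / β) hD hf hβ hη hθ hi
        fun ϑ hϑ => hdev θ hθ ϑ (hD.segment_subset hθ hi hϑ)
      rw [hinner, hgJ, ← hT, ← hgJ] at h
      have h1 : (1 - 1 / 2) * α ^ 2 / β * ‖f θ - y‖ ≤ T / 2 := by
        have : (1 - 1 / 2) * α ^ 2 / β ≤ α / 2 := by
          rw [div_le_iff₀ hβ0]
          nlinarith
        nlinarith [mul_le_mul_of_nonneg_right this (norm_nonneg (f θ - y))]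
      have h2 := mul_le_mul_of_nonneg_right h1 (mul_nonneg hη (norm_nonneg
        (ContinuousLinearMap.adjoint (jacobian f θ) (f θ - y))))
      rw [← hT] at h2
      have h3 := mul_le_mul_of_nonneg_right hsmall (mul_nonneg hη (sq_nonneg T))
      nlinarith
  refine ⟨3 / 4 * T ^ 2, ?_, ?_, ?_, ?_⟩
  · rw [residualSqOn_of_mem hθ, Fin.sum_univ_one]
    simpa using hle
  · rw [residualSqOn_of_mem hθ]
    nlinarith
  · rw [residualSqOn_of_mem hθ, Real.sqrt_sq (norm_nonneg _), sum_sampleGradient (hf θ hθ), ← hT]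
    nlinarith [mul_le_mul_of_nonneg_left hTF (norm_nonneg
      (ContinuousLinearMap.adjoint (jacobian f θ) (f θ - y))), sq_nonneg T]
  · nlinarith

/-- The cost minimized over `ϑ` in the regularized squared residual at `θ`. The linear part `A` of
the residual is evaluated at `θ`, the rest at `ϑ`. -/
noncomputable def shadowCost (f : RVec p → RVec n) (y : RVec n) (A : RVec p →L[ℝ] RVec n) (K : ℝ)
    (θ ϑ : RVec p) : ℝ :=
  ‖A (θ - ϑ) + (f ϑ - y)‖ ^ 2 + K * ‖θ - ϑ‖ ^ 2

theorem shadowCost_self (f : RVec p → RVec n) (y : RVec n) (A : RVec p →L[ℝ] RVec n) (K : ℝ)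
    (θ : RVec p) : shadowCost f y A K θ θ = ‖f θ - y‖ ^ 2 := by
  simp [shadowCost]

theorem exists_isMinOn_shadowCost {f : RVec p → RVec n} (y : RVec n) (A : RVec p →L[ℝ] RVec n)
    (K : ℝ) {D : Set (RVec p)} (hD : IsCompact D) (hne : D.Nonempty)
    (hf : ∀ ϑ ∈ D, DifferentiableAt ℝ f ϑ) (θ : RVec p) :
    ∃ ϑ ∈ D, IsMinOn (shadowCost f y A K θ) D ϑ := by
  have hfc : ContinuousOn f D := fun ϑ h => (hf ϑ h).continuousAt.continuousWithinAt
  refine hD.exists_isMinOn hne ?_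
  unfold shadowCost
  fun_prop

/-- With w = A(θ−ϑ) + f(ϑ) − y this reads J(ϑ)ᵀw = Aᵀw + K(θ−ϑ). The right side is half the gradient
of the cost in θ at fixed ϑ, so the cost descends along a vector J(ϑ)ᵀw comparable to J(θ)ᵀr. -/
theorem shadowCost_stationary {f : RVec p → RVec n} {y : RVec n} {A : RVec p →L[ℝ] RVec n}
    {K : ℝ} {θ ϑ : RVec p} (hf : DifferentiableAt ℝ f ϑ)
    (hmin : IsLocalMin (shadowCost f y A K θ) ϑ) (v : RVec p) :
    inner ℝ (A (θ - ϑ) + (f ϑ - y)) (jacobian f ϑ v)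
      = inner ℝ (A (θ - ϑ) + (f ϑ - y)) (A v) + K * inner ℝ (θ - ϑ) v := by
  have hsub : HasFDerivAt (fun ϑ => θ - ϑ) (-ContinuousLinearMap.id ℝ (RVec p)) ϑ :=
    (hasFDerivAt_id ϑ).const_sub θ
  have hw : HasFDerivAt (fun ϑ => A (θ - ϑ) + (f ϑ - y))
      (A.comp (-ContinuousLinearMap.id ℝ (RVec p)) + jacobian f ϑ) ϑ :=
    (A.hasFDerivAt.comp ϑ hsub).add (hf.hasFDerivAt.sub_const y)
  have h := hmin.hasFDerivAt_eq_zero (hw.norm_sq.add (hsub.norm_sq.const_mul K))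
  have hv := congrArg (fun l : RVec p →L[ℝ] ℝ => l v) h
  simp only [add_apply, smul_apply, ContinuousLinearMap.comp_apply, neg_apply,
    ContinuousLinearMap.id_apply, innerSL_apply_apply, map_neg, inner_add_right, inner_neg_right,
    zero_apply, smul_eq_mul, nsmul_eq_mul, Nat.cast_ofNat] at hv
  linarith

/-- Here r = w + error with the error at most (β/2)‖θ−ϑ‖. Young's inequality with weight ν gives the
factor 1 + 1/ν exactly when K = νβ²/4. -/
theorem norm_residual_sq_le_shadowCost {f : RVec p → RVec n} {y : RVec n} {D : Set (RVec p)}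
    (hD : Convex ℝ D) {A : RVec p →L[ℝ] RVec n} {δ β ν : ℝ}
    (hf : ∀ ϑ ∈ D, DifferentiableAt ℝ f ϑ) (hA : ∀ ϑ ∈ D, ‖jacobian f ϑ - A‖ ≤ δ)
    (hδ0 : 0 ≤ δ) (hδ : δ ≤ β / 2) (hν : 0 < ν) {θ ϑ : RVec p} (hθ : θ ∈ D) (hϑ : ϑ ∈ D) :
    ‖f θ - y‖ ^ 2 ≤ (1 + 1 / ν) * shadowCost f y A (ν * β ^ 2 / 4) θ ϑ := by
  have h := hD.norm_image_sub_le_of_norm_fderiv_le' hf hA hϑ hθ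
  set w := A (θ - ϑ) + (f ϑ - y) with hw
  set u := θ - ϑ with hu
  have h1 : f θ - y = w + (f θ - f ϑ - A u) := by rw [hw]; abel
  have h2 : ‖f θ - y‖ ≤ ‖w‖ + δ * ‖u‖ := by
    rw [h1]
    exact (norm_add_le _ _).trans (by linarith)
  have h3 := pow_le_pow_left₀ (norm_nonneg _) h2 2
  have h4 : δ ^ 2 ≤ β ^ 2 / 4 := by nlinarith
  have h5 := mul_le_mul_of_nonneg_right h4 (sq_nonneg ‖u‖)
  refine h3.trans ?_
  rw [shadowCost, ← hu, ← hw]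
  have h6 : (1 + 1 / ν) * (‖w‖ ^ 2 + ν * β ^ 2 / 4 * ‖u‖ ^ 2) - (‖w‖ + δ * ‖u‖) ^ 2
      = (1 / ν) * (‖w‖ - ν * (δ * ‖u‖)) ^ 2
        + (ν + 1) * (β ^ 2 / 4 * ‖u‖ ^ 2 - δ ^ 2 * ‖u‖ ^ 2) := by
    field_simp
    ring
  have h7 : 0 ≤ (1 / ν) * (‖w‖ - ν * (δ * ‖u‖)) ^ 2 := by positivity
  have h8 : 0 ≤ (ν + 1) * (β ^ 2 / 4 * ‖u‖ ^ 2 - δ ^ 2 * ‖u‖ ^ 2) :=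
    mul_nonneg (by linarith) (by linarith)
  linarith

/-- With W = ‖w‖, U = ‖θ−ϑ‖ and e = ‖r−w‖: stationarity and K ≥ β² force βU ≤ W/2, so the minimizer
is near θ and w is near r. -/
theorem shadow_distance_bounds {α β K δ W U e : ℝ} (hα : 0 < α) (hαβ : α ≤ β)
    (hδ : δ = (1 - 1 / 2) * α ^ 2 / β) (hK : β ^ 2 ≤ K) (hW : 0 ≤ W) (hU : 0 ≤ U)
    (hKU : K * U ≤ δ * W) (he : e ≤ δ * U) :
    δ ≤ α / 2 ∧ K * U ^ 2 ≤ W ^ 2 / 4 ∧ e ≤ W / 4 ∧ β * e ≤ α * W / 4 := by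
  have hβ : 0 < β := hα.trans_le hαβ
  have hδα : δ ≤ α / 2 := by
    rw [hδ, div_le_iff₀ hβ]
    nlinarith
  have hδ0 : 0 ≤ δ := by
    rw [hδ]
    apply div_nonneg _ hβ.le
    nlinarith [sq_nonneg α]
  have h1 : β ^ 2 * U ≤ δ * W := (mul_le_mul_of_nonneg_right hK hU).trans hKU
  have h2 : δ * W ≤ α / 2 * W := mul_le_mul_of_nonneg_right hδα hW
  have h3 : β * U ≤ W / 2 := by
    have : β * (β * U) ≤ β * (W / 2) := by nlinarith
    exact le_of_mul_le_mul_left this hβ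
  have h4 : δ * U ≤ α / 2 * U := mul_le_mul_of_nonneg_right hδα hU
  have h5 : α * U ≤ β * U := mul_le_mul_of_nonneg_right hαβ hU
  refine ⟨hδα, ?_, by linarith, ?_⟩
  · nlinarith [mul_le_mul_of_nonneg_right hKU hU, mul_le_mul_of_nonneg_right h2 hU]
  · nlinarith [mul_le_mul_of_nonneg_left he hβ.le, mul_le_mul_of_nonneg_left h4 hβ.le]

theorem norm_sq_add_le_two_mul_inner {E : Type*} [NormedAddCommGroup E] [InnerProductSpace ℝ E]
    {a t : E} {c : ℝ} (hc : 0 ≤ c) (ha : c ≤ ‖a‖) (hat : ‖a - t‖ ≤ 3 / 4 * c) :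
    ‖t‖ ^ 2 + 7 / 16 * c ^ 2 ≤ 2 * inner ℝ a t := by
  have h1 := norm_sub_sq_real a t
  have h2 := pow_le_pow_left₀ (norm_nonneg _) hat 2
  have h3 := pow_le_pow_left₀ hc ha 2
  linarith

theorem norm_sq_bounds_of_norm_sub_le {E : Type*} [NormedAddCommGroup E] {r w : E}
    (h : ‖r - w‖ ≤ ‖w‖ / 4) :
    9 / 16 * ‖w‖ ^ 2 ≤ ‖r‖ ^ 2 ∧ ‖r‖ ^ 2 ≤ 25 / 16 * ‖w‖ ^ 2 := by
  have h1 := norm_sub_norm_le r w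
  have h2 := norm_sub_norm_le w r
  rw [norm_sub_rev] at h2
  have h0 := norm_nonneg w
  constructor
  · have := pow_le_pow_left₀ (by positivity) (show 3 / 4 * ‖w‖ ≤ ‖r‖ by linarith) 2
    linarith
  · have := pow_le_pow_left₀ (norm_nonneg _) (show ‖r‖ ≤ 5 / 4 * ‖w‖ by linarith) 2
    linarith

/-- One step with the minimizer `ϑ` kept fixed. -/
theorem shadowCost_step_le {f : RVec p → RVec n} {y : RVec n} {A : RVec p →L[ℝ] RVec n}
    {K β η : ℝ} (hA : ‖A‖ ≤ β) {θ ϑ a g : RVec p}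
    (ha : inner ℝ a g = inner ℝ (A (θ - ϑ) + (f ϑ - y)) (A g) + K * inner ℝ (θ - ϑ) g) :
    shadowCost f y A K (θ - η • g) ϑ
      ≤ shadowCost f y A K θ ϑ - 2 * η * inner ℝ a g + η ^ 2 * (β ^ 2 + K) * ‖g‖ ^ 2 := by
  have h1 : θ - η • g - ϑ = (θ - ϑ) - η • g := by abel
  have h2 : A ((θ - ϑ) - η • g) + (f ϑ - y) = (A (θ - ϑ) + (f ϑ - y)) - η • A g := by
    rw [A.map_sub (θ - ϑ), map_smul]
    abel
  have h3 : ‖A g‖ ^ 2 ≤ (β * ‖g‖) ^ 2 := pow_le_pow_left₀ (norm_nonneg _)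
    ((ContinuousLinearMap.le_opNorm _ _).trans
      (mul_le_mul_of_nonneg_right hA (norm_nonneg _))) 2
  have h4 := mul_le_mul_of_nonneg_left h3 (sq_nonneg η)
  rw [shadowCost, shadowCost, h1, h2, norm_sub_sq_real, norm_sub_sq_real (θ - ϑ), norm_smul,
    norm_smul, inner_smul_right, inner_smul_right, mul_pow, mul_pow, Real.norm_eq_abs, sq_abs, ha]
  linarith

theorem shadow_step_size_le {α β B ν η : ℝ} (hν : 4 ≤ ν)
    (hsmall : η * (ν * β ^ 2 * B ^ 2) ≤ α ^ 2) :
    η * (β ^ 2 + ν * β ^ 2 / 4) * B ^ 2 ≤ α ^ 2 / 2 := by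
  have h1 : η * (β ^ 2 + ν * β ^ 2 / 4) * B ^ 2
      = (1 / ν + 1 / 4) * (η * (ν * β ^ 2 * B ^ 2)) := by
    have : ν ≠ 0 := by linarith
    field_simp
  have h2 : 1 / ν ≤ 1 / 4 := one_div_le_one_div_of_le (by norm_num) hν
  have h3 : 0 ≤ 1 / ν := by positivity
  rw [h1]
  nlinarith [sq_nonneg α,
    mul_le_mul_of_nonneg_left hsmall (add_nonneg h3 (by norm_num : (0 : ℝ) ≤ 1 / 4))]

/-- The three lower bounds on d for the regularized residual, with X the penalty K‖θ−ϑ‖², T =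
‖J(θ)ᵀr‖ and q = √Φ. -/
theorem shadow_decrease_bounds {α W X F T q : ℝ} (hX : X ≤ W ^ 2 / 4)
    (hF1 : 9 / 16 * W ^ 2 ≤ F) (hF2 : F ≤ 25 / 16 * W ^ 2) (hT : α ^ 2 * F ≤ T ^ 2)
    (hq : q ^ 2 = W ^ 2 + X) :
    9 / 16 * α ^ 2 * (W ^ 2 + X) ≤ T ^ 2 + 7 / 16 * α ^ 2 * W ^ 2 - 1 / 2 * α ^ 2 * F ∧
    8 / 11 * α * T * q ≤ T ^ 2 + 7 / 16 * α ^ 2 * W ^ 2 - 1 / 2 * α ^ 2 * F ∧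
    5 / 7 * α ^ 2 * F ≤ T ^ 2 + 7 / 16 * α ^ 2 * W ^ 2 - 1 / 2 * α ^ 2 * F := by
  have h1 := mul_le_mul_of_nonneg_left hX (sq_nonneg α)
  have h2 := mul_le_mul_of_nonneg_left hF1 (sq_nonneg α)
  have h3 := mul_le_mul_of_nonneg_left hF2 (sq_nonneg α)
  refine ⟨by linarith, ?_, by linarith⟩
  have h4 : (α * q) ^ 2 = α ^ 2 * W ^ 2 + α ^ 2 * X := by rw [mul_pow, hq]; ring
  have h5 : 8 / 11 * α * T * q ≤ 1 / 2 * T ^ 2 + 7 / 20 * (α * q) ^ 2 := by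
    nlinarith [sq_nonneg (T - 8 / 11 * (α * q)), sq_nonneg (α * q)]
  linarith

/-- Keeping the old minimizer bounds the new minimum from above by a quadratic in the step. Its
linear part sums over the samples to ⟨J(ϑ)ᵀw, J(θ)ᵀr⟩, so only the full gradient matters to first
order. -/
theorem lyapunovDecrease_shadow {f : RVec p → RVec n} {y : RVec n} {D : Set (RVec p)}
    (hn : n ≠ 0) (hD : Convex ℝ D) {α β B ν η : ℝ} (hα : 0 < α) (hαβ : α ≤ β)
    (hν : 4 ≤ ν) (hη : 0 ≤ η)
    (hf : ∀ ϑ ∈ D, DifferentiableAt ℝ f ϑ) (hβ : ∀ ϑ ∈ D, ‖jacobian f ϑ‖ ≤ β)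
    (hlow : ∀ ϑ ∈ D, ∀ w, α * ‖w‖ ≤ ‖ContinuousLinearMap.adjoint (jacobian f ϑ) w‖)
    (hrow : ∀ θ ∈ D, ∀ i, ‖jacobianRow f i θ‖ ≤ B)
    (hdev : JacobianBoundedDeviation f D α β (1 / 2)) (hsmall : η * (ν * β ^ 2 * B ^ 2) ≤ α ^ 2)
    {θ₀ : RVec p} (hθ₀ : θ₀ ∈ D) {π : RVec p → RVec p} (hπD : ∀ θ, π θ ∈ D)
    (hπ : ∀ θ, IsMinOn (shadowCost f y (jacobian f θ₀) (ν * β ^ 2 / 4) θ) D (π θ))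
    {θ : RVec p} (hθ : θ ∈ D) (hint : D ∈ nhds (π θ)) :
    LyapunovDecrease f y η α
      (fun ϑ => shadowCost f y (jacobian f θ₀) (ν * β ^ 2 / 4) ϑ (π ϑ)) θ := by
  have hn' : (0 : ℝ) < n := by positivity
  have hβ0 : 0 < β := hα.trans_le hαβ
  have hstat := shadowCost_stationary (hf (π θ) (hπD θ)) ((hπ θ).isLocalMin hint)
  have hsmall' := shadow_step_size_le hν hsmall
  have hK' : β ^ 2 ≤ ν * β ^ 2 / 4 := by nlinarith [sq_nonneg β]
  have hδ0 : 0 ≤ (1 - 1 / 2) * α ^ 2 / β := by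
    rw [show (1 : ℝ) - 1 / 2 = 1 / 2 by norm_num]
    positivity
  have hϑD : π θ ∈ D := hπD θ
  have hεu := hD.norm_image_sub_le_of_norm_fderiv_le' hf (fun z hz => hdev θ₀ hθ₀ z hz) hϑD hθ
  have hmin : ∀ g : RVec p, shadowCost f y (jacobian f θ₀) (ν * β ^ 2 / 4) (θ - η • g)
      (π (θ - η • g)) ≤ shadowCost f y (jacobian f θ₀) (ν * β ^ 2 / 4) (θ - η • g) (π θ) :=
    fun g => hπ _ hϑD
  generalize hK : ν * β ^ 2 / 4 = K at *
  have hAβ := hβ θ₀ hθ₀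
  have hAdev := hdev θ₀ hθ₀ (π θ) hϑD
  generalize jacobian f θ₀ = A at *
  have hstep := fun g : RVec p => (hmin g).trans (shadowCost_step_le (η := η) hAβ
    (a := ContinuousLinearMap.adjoint (jacobian f (π θ))
      (A (θ - π θ) + (f (π θ) - y)))
    (by rw [ContinuousLinearMap.adjoint_inner_left]; exact hstat g))
  have hcost : shadowCost f y A K θ (π θ)
      = ‖A (θ - π θ) + (f (π θ) - y)‖ ^ 2 + K * ‖θ - π θ‖ ^ 2 := rfl
  have hεr : f θ - f (π θ) - A (θ - π θ) = (f θ - y) - (A (θ - π θ) + (f (π θ) - y)) := by abel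
  rw [hεr] at hεu
  generalize A (θ - π θ) + (f (π θ) - y) = w at *
  -- Stationarity tested in the direction θ − π θ.
  have hKu : K * ‖θ - π θ‖ ≤ (1 - 1 / 2) * α ^ 2 / β * ‖w‖ := by
    have h1 : K * ‖θ - π θ‖ ^ 2 = inner ℝ w ((jacobian f (π θ) - A) (θ - π θ)) := by
      rw [sub_apply, inner_sub_right, hstat (θ - π θ), real_inner_self_eq_norm_sq]
      ring
    have h2 := (real_inner_le_norm w ((jacobian f (π θ) - A) (θ - π θ))).trans
      (mul_le_mul_of_nonneg_left ((ContinuousLinearMap.le_opNorm _ _).trans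
        (mul_le_mul_of_nonneg_right hAdev (norm_nonneg _))) (norm_nonneg _))
    rcases (norm_nonneg (θ - π θ)).eq_or_lt with h0 | h0
    · rw [← h0, mul_zero]
      positivity
    · refine le_of_mul_le_mul_right ?_ h0
      linarith
  obtain ⟨hδα, hKu2, hεW, hβε⟩ := shadow_distance_bounds hα hαβ rfl hK' (norm_nonneg w)
    (norm_nonneg _) hKu hεu
  obtain ⟨hF1, hF2⟩ := norm_sq_bounds_of_norm_sub_le hεW
  have htF := pow_le_pow_left₀ (by positivity) (hlow θ hθ (f θ - y)) 2
  rw [mul_pow] at htF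
  have hpol := norm_sq_add_le_two_mul_inner (c := α * ‖w‖)
    (t := ContinuousLinearMap.adjoint (jacobian f θ) (f θ - y)) (by positivity)
    (hlow (π θ) hϑD w) (by
      -- The two differences contribute at most (α/2)‖w‖ and (α/4)‖w‖, hence the constant 3/4.
      have h1 : ContinuousLinearMap.adjoint (jacobian f (π θ)) w
          - ContinuousLinearMap.adjoint (jacobian f θ) (f θ - y)
          = ContinuousLinearMap.adjoint (jacobian f (π θ) - jacobian f θ) w
          - ContinuousLinearMap.adjoint (jacobian f θ) ((f θ - y) - w) := by
        rw [map_sub (ContinuousLinearMap.adjoint (jacobian f θ)) (f θ - y) w,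
          map_sub ContinuousLinearMap.adjoint, sub_apply]
        abel
      have h2 := norm_adjoint_apply_le (hdev θ hθ (π θ) hϑD) w
      have h3 := norm_adjoint_apply_le (hβ θ hθ) ((f θ - y) - w)
      have h4 := mul_le_mul_of_nonneg_right hδα (norm_nonneg w)
      rw [h1]
      refine (norm_sub_le _ _).trans ?_
      linarith)
  have hg2 : ∑ i, ‖sampleGradient f y θ i‖ ^ 2 ≤ B ^ 2 * ‖f θ - y‖ ^ 2 :=
    sum_norm_sampleGradient_sq_le fun i => pow_le_pow_left₀ (norm_nonneg _) (hrow θ hθ i) 2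
  have hgt := inner_sum (𝕜 := ℝ) Finset.univ (sampleGradient f y θ)
    (ContinuousLinearMap.adjoint (jacobian f (π θ)) w)
  rw [sum_sampleGradient (hf θ hθ)] at hgt
  have hb := shadow_decrease_bounds (q := √(‖w‖ ^ 2 + K * ‖θ - π θ‖ ^ 2)) hKu2 hF1 hF2 htF
    (Real.sq_sqrt (by
      have : 0 ≤ K := (sq_nonneg β).trans hK'
      positivity))
  refine ⟨‖ContinuousLinearMap.adjoint (jacobian f θ) (f θ - y)‖ ^ 2
    + 7 / 16 * α ^ 2 * ‖w‖ ^ 2 - 1 / 2 * α ^ 2 * ‖f θ - y‖ ^ 2, ?_, ?_⟩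
  rotate_left
  · simp only [hcost, sum_sampleGradient (hf θ hθ)]
    exact hb
  · simp only [hcost] at hstep ⊢
    rw [div_le_iff₀ hn']
    refine (Finset.sum_le_sum fun i _ => hstep (sampleGradient f y θ i)).trans ?_
    simp only [Finset.sum_add_distrib, Finset.sum_sub_distrib, ← Finset.mul_sum, ← hgt,
      Finset.sum_const, Finset.card_univ, Fintype.card_fin, nsmul_eq_mul]
    have h1 : η ^ 2 * (β ^ 2 + K) * ∑ i, ‖sampleGradient f y θ i‖ ^ 2
        ≤ η ^ 2 * (β ^ 2 + K) * (B ^ 2 * ‖f θ - y‖ ^ 2) :=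
      mul_le_mul_of_nonneg_left hg2 (mul_nonneg (sq_nonneg η) (by nlinarith [sq_nonneg β]))
    have h2 := mul_le_mul_of_nonneg_right hsmall' (mul_nonneg hη (sq_nonneg ‖f θ - y‖))
    have h3 := mul_le_mul_of_nonneg_left hpol hη
    rw [sub_mul, mul_right_comm (η / n), div_mul_cancel₀ _ hn'.ne']
    linarith

end Decrease

/-! ### From a Lyapunov function to the event -/

section Events

variable {p n : ℕ} {Ω : Type*} [MeasurableSpace Ω] {P : Measure Ω} [IsProbabilityMeasure P]
  {γ : ℕ → Ω → Fin n}

theorem norm_sgd_sub_le_of_mem_stayEvent {f : RVec p → RVec n} {y : RVec n} {η α R : ℝ}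
    (hα : 0 ≤ α) {θ₀ : RVec p} {Φ : RVec p → ℝ} {Ω : Type*} {γ : ℕ → Ω → Fin n} {ω : Ω}
    (hω : ω ∈ stayEvent (sgdLiftStep f y η) (θ₀, 0) (sgdRegion θ₀ α R Φ) γ) (τ : ℕ) :
    α * ‖sgd f y η θ₀ (fun t => γ t ω) τ - θ₀‖ ≤ R := by
  have h := norm_sub_le_of_mem_sgdRegion hα (mem_of_mem_stayEvent hω τ)
  rw [drivenChain_sgdLiftStep_fst] at h
  have := Real.sqrt_nonneg (Φ (sgd f y η θ₀ (fun t => γ t ω) τ))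
  linarith

theorem IsUniformSampling.integrable_indicator_sgd (hγ : IsUniformSampling P γ)
    (f : RVec p → RVec n) (y : RVec n) (η : ℝ) (θ₀ : RVec p) (F : RVec p → ℝ) {E : Set Ω}
    (hE : MeasurableSet E) (τ : ℕ) :
    Integrable (E.indicator fun ω => F (sgd f y η θ₀ (fun t => γ t ω) τ)) P := by
  simp_rw [← drivenChain_sgdLiftStep_fst f y η θ₀ 0]
  exact hγ.integrable_indicator_drivenChain (sgdLiftStep f y η) (θ₀, 0) (fun x => F x.1) hE τ

/-- A Lyapunov function that dominates the squared residual. -/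
theorem IsUniformSampling.exists_event_of_lyapunov (hγ : IsUniformSampling P γ) (hn : n ≠ 0)
    {f : RVec p → RVec n} {y : RVec n} {η α ν : ℝ}
    (hη : 0 < η) (hα : 0 < α) (hν : 0 < ν) (hηα : η * α ^ 2 / n ≤ 1)
    {θ₀ : RVec p} (h0 : 0 < ‖f θ₀ - y‖)
    {Φ : RVec p → ℝ} (hΦ0 : ∀ θ, 0 ≤ Φ θ) (hΦi : Φ θ₀ ≤ ‖f θ₀ - y‖ ^ 2)
    (hvar : ∀ θ, α * ‖θ - θ₀‖ ≤ ν * ‖f θ₀ - y‖ →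
      η * ∑ i, ‖sampleGradient f y θ i‖ ^ 2 ≤ ‖f θ - y‖ ^ 2 / 4)
    (hdec : ∀ θ, α * ‖θ - θ₀‖ + 11 / 4 * √(Φ θ) < ν * ‖f θ₀ - y‖ →
      LyapunovDecrease f y η α Φ θ)
    (hF : ∀ θ, α * ‖θ - θ₀‖ ≤ ν * ‖f θ₀ - y‖ → ‖f θ - y‖ ^ 2 ≤ Φ θ) :
    ∃ E : Set Ω, MeasurableSet E ∧ 1 - 45 / 4 / ν ^ 2 ≤ P.real E ∧
      (∀ ω ∈ E, ∀ τ, α * ‖sgd f y η θ₀ (fun t => γ t ω) τ - θ₀‖ ≤ ν * ‖f θ₀ - y‖) ∧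
      ∀ τ, ∫ ω, E.indicator (fun ω => ‖f (sgd f y η θ₀ (fun t => γ t ω) τ) - y‖ ^ 2) ω ∂P
          ≤ (1 - 9 / 16 * (η * α ^ 2 / n)) ^ τ * ‖f θ₀ - y‖ ^ 2 := by
  set R := ν * ‖f θ₀ - y‖ with hR
  set G := sgdRegion θ₀ α R Φ with hG
  set step := sgdLiftStep f y η with hstep
  have hc : 0 ≤ 1 - 9 / 16 * (η * α ^ 2 / n) := by linarith
  have hEm := hγ.measurableSet_stayEvent step (θ₀, 0) G
  refine ⟨stayEvent step (θ₀, 0) G γ, hEm,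
    hγ.stayEvent_sgdRegion_ge hn hη hα hν h0 hΦ0 hΦi hvar hdec,
    fun ω hω τ => norm_sgd_sub_le_of_mem_stayEvent hα.le hω τ, fun τ => ?_⟩
  set F : RVec p × RVec p → ℝ := fun x => ‖f x.1 - y‖ ^ 2 with hFdef
  have hint := hγ.integrable_indicator_drivenChain step (θ₀, 0) F hEm τ
  have hle := hγ.integral_indicator_stayEvent_le step (θ₀, 0) G (fun x => Φ x.1) F hc zero_le_one
    (fun x => hΦ0 x.1)
    (fun x hx => avg_lyapunov_le hn hη (hdec x.1 (norm_sub_le_of_mem_sgdRegion hα.le hx)))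
    (fun x hx => by
      have h1 := norm_sub_le_of_mem_sgdRegion hα.le hx
      have h2 := Real.sqrt_nonneg (Φ x.1)
      rw [one_mul]
      exact hF x.1 (by linarith)) τ
  calc _ = ∫ ω, (stayEvent step (θ₀, 0) G γ).indicator
        (fun ω => F (drivenChain step (θ₀, 0) (fun t => γ t ω) τ)) ω ∂P := by
        simp only [hFdef, hstep, drivenChain_sgdLiftStep_fst]
    _ ≤ _ := integral_mono hint (hγ.integrable_drivenChain _ (θ₀, 0) (G.indicator F) τ)
        fun ω => indicator_stayEvent_le step (θ₀, 0) G F (fun x => sq_nonneg _) τ ω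
    _ ≤ _ := hle
    _ ≤ _ := by
        rw [one_mul]
        exact mul_le_mul_of_nonneg_left hΦi (pow_nonneg hc τ)

/-- A Lyapunov function that dominates the squared residual up to the factor `1 + 1 / ν`. -/
theorem IsUniformSampling.exists_event_of_lyapunov_of_le_mul (hγ : IsUniformSampling P γ)
    (hn : 2 ≤ n) {f : RVec p → RVec n} {y : RVec n} {η α ν : ℝ}
    (hη : 0 < η) (hα : 0 < α) (hν : 4 ≤ ν) (hηα : η * α ^ 2 / n ≤ 1)
    {θ₀ : RVec p} (h0 : 0 < ‖f θ₀ - y‖)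
    {Φ : RVec p → ℝ} (hΦ0 : ∀ θ, 0 ≤ Φ θ) (hΦi : Φ θ₀ ≤ ‖f θ₀ - y‖ ^ 2)
    (hvar : ∀ θ, α * ‖θ - θ₀‖ ≤ ν * ‖f θ₀ - y‖ →
      η * ∑ i, ‖sampleGradient f y θ i‖ ^ 2 ≤ ‖f θ - y‖ ^ 2 / 4)
    (hdec : ∀ θ, α * ‖θ - θ₀‖ + 11 / 4 * √(Φ θ) < ν * ‖f θ₀ - y‖ →
      LyapunovDecrease f y η α Φ θ)
    (hF : ∀ θ, α * ‖θ - θ₀‖ ≤ ν * ‖f θ₀ - y‖ → ‖f θ - y‖ ^ 2 ≤ (1 + 1 / ν) * Φ θ) :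
    ∃ E : Set Ω, MeasurableSet E ∧ 1 - 4 / ν ≤ P.real E ∧
      (∀ ω ∈ E, ∀ τ, α * ‖sgd f y η θ₀ (fun t => γ t ω) τ - θ₀‖ ≤ ν * ‖f θ₀ - y‖) ∧
      ∀ τ, ∫ ω, E.indicator (fun ω => ‖f (sgd f y η θ₀ (fun t => γ t ω) τ) - y‖ ^ 2) ω ∂P
          ≤ (1 - 1 / 2 * (η * α ^ 2 / n)) ^ τ * ‖f θ₀ - y‖ ^ 2 := by
  have hn0 : n ≠ 0 := by omega
  have hn' : (0 : ℝ) < n := by positivity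
  have hν0 : 0 < ν := by linarith
  set R := ν * ‖f θ₀ - y‖ with hR
  set G := sgdRegion θ₀ α R Φ with hG
  set step := sgdLiftStep f y η with hstep
  have hx : 0 < η * α ^ 2 / n := by positivity
  have hc : 0 ≤ 1 - 9 / 16 * (η * α ^ 2 / n) := by linarith
  have hstay := hγ.stayEvent_sgdRegion_ge hn0 hη hα hν0 h0 hΦ0 hΦi hvar hdec
  -- The left side is the least probability of the independent event that still leaves 4/ν in total
  -- after the exit probability; the right side is the reciprocal of 1 + 1/ν. For ν ≥ 4 there is
  -- room between them.
  have hgap : 1 - 4 / ν + 45 / 4 / ν ^ 2 < ν / (ν + 1) := by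
    have h1 : ν / (ν + 1) - (1 - 4 / ν + 45 / 4 / ν ^ 2)
        = (12 * ν ^ 2 - 29 * ν - 45) / (4 * ν ^ 2 * (ν + 1)) := by
      field_simp
      ring
    have h2 : 0 < (12 * ν ^ 2 - 29 * ν - 45) / (4 * ν ^ 2 * (ν + 1)) :=
      div_pos (by nlinarith) (by positivity)
    linarith
  set F : RVec p × RVec p → ℝ := fun x => ‖f x.1 - y‖ ^ 2 with hFdef
  obtain ⟨E, hEm, hEs, hEP, hEi⟩ := hγ.exists_event_integral_le hn step (θ₀, 0) G
    (fun x => Φ x.1) F (ρ := 1 - 1 / 2 * (η * α ^ 2 / n)) (C := 1 + 1 / ν) (hi := ν / (ν + 1)) hc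
    (by linarith) (by positivity) (fun x => hΦ0 x.1)
    (fun x hx => avg_lyapunov_le hn0 hη (hdec x.1 (norm_sub_le_of_mem_sgdRegion hα.le hx)))
    (fun x => sq_nonneg _)
    (fun x hx => by
      have h1 := norm_sub_le_of_mem_sgdRegion hα.le hx
      have h2 := Real.sqrt_nonneg (Φ x.1)
      exact hF x.1 (by linarith))
    (by positivity) (by rw [div_le_one (by positivity)]; linarith) hgap
    (le_of_eq (by field_simp))
  refine ⟨E, hEm, by linarith, fun ω hω τ => norm_sgd_sub_le_of_mem_stayEvent hα.le (hEs hω) τ,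
    fun τ => ?_⟩
  have h := (hEi τ).trans (mul_le_mul_of_nonneg_left hΦi (pow_nonneg (by linarith) τ))
  simpa only [hFdef, hstep, drivenChain_sgdLiftStep_fst] using h

end Events

/-! ### The two deviation conditions and the degenerate cases -/

section Main

variable {p n : ℕ}

theorem sgd_eq_of_smul_sampleGradient_eq_zero {f : RVec p → RVec n} {y : RVec n} {η : ℝ}
    {θ₀ : RVec p} (h : ∀ i, η • sampleGradient f y θ₀ i = 0) (g : ℕ → Fin n) (τ : ℕ) :
    sgd f y η θ₀ g τ = θ₀ := by
  induction τ with
  | zero => rfl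
  | succ τ ih => rw [sgd, ih, h, sub_zero]

/-- A Lipschitz constant of a map on a ball of positive radius is nonnegative. -/
theorem JacobianSmoothDeviation.nonneg {f : RVec p → RVec n} {L R : ℝ} {θ₀ v : RVec p}
    (hR : 0 < R) (hv : v ≠ 0) (h : JacobianSmoothDeviation f (Metric.closedBall θ₀ R) L) :
    0 ≤ L := by
  have hv' : 0 < ‖v‖ := norm_pos_iff.2 hv
  have hnorm : ‖θ₀ + (R / ‖v‖) • v - θ₀‖ = R := by
    rw [add_sub_cancel_left, norm_smul, Real.norm_of_nonneg (by positivity),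
      div_mul_cancel₀ _ hv'.ne']
  have h1 := h θ₀ (Metric.mem_closedBall_self hR.le) (θ₀ + (R / ‖v‖) • v)
    (by rw [mem_closedBall_iff_norm, hnorm])
  rw [hnorm] at h1
  exact nonneg_of_mul_nonneg_left ((norm_nonneg _).trans h1) hR

theorem IsUniformSampling.exists_event_sgd {Ω : Type*} [MeasurableSpace Ω] {P : Measure Ω}
    [IsProbabilityMeasure P] {γ : ℕ → Ω → Fin n} (hγ : IsUniformSampling P γ) (hn : n ≠ 0)
    {f : RVec p → RVec n} {y : RVec n} {θ₀ : RVec p} {α β B ν η : ℝ} (hα : 0 < α) (hαβ : α ≤ β)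
    (hαB : α ≤ B) (hν : 4 ≤ ν) (hη : 0 < η) (h0 : 0 < ‖f θ₀ - y‖)
    {D : Set (RVec p)} (hD : D = Metric.closedBall θ₀ (ν * (‖f θ₀ - y‖ / α)))
    (hf : ∀ ϑ ∈ D, DifferentiableAt ℝ f ϑ) (hβ : ∀ ϑ ∈ D, ‖jacobian f ϑ‖ ≤ β)
    (hlow : ∀ ϑ ∈ D, ∀ w, α * ‖w‖ ≤ ‖ContinuousLinearMap.adjoint (jacobian f ϑ) w‖)
    (hrow : ∀ θ ∈ D, ∀ i, ‖jacobianRow f i θ‖ ≤ B)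
    (hdev :
      (JacobianBoundedDeviation f D α β (1 / 2) ∧ η * (ν * β ^ 2 * B ^ 2) ≤ α ^ 2) ∨
      (∃ L : ℝ, 0 ≤ L ∧ JacobianSmoothDeviation f D L ∧
        η * (ν * β ^ 2 * B ^ 2 + ν * β * B * L * ‖f θ₀ - y‖) ≤ α ^ 2)) :
    ∃ E : Set Ω, MeasurableSet E ∧ 1 - 4 / ν ≤ P.real E ∧
      (∀ ω ∈ E, ∀ τ, sgd f y η θ₀ (fun t => γ t ω) τ ∈ D) ∧
      ∀ τ, ∫ ω, E.indicator (fun ω => ‖f (sgd f y η θ₀ (fun t => γ t ω) τ) - y‖ ^ 2) ω ∂P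
          ≤ (1 - 1 / 2 * (η * α ^ 2 / n)) ^ τ * ‖f θ₀ - y‖ ^ 2 := by
  have hβ0 : 0 < β := hα.trans_le hαβ
  have hB0 : 0 < B := hα.trans_le hαB
  have hν0 : 0 < ν := by linarith
  have hn1 : (1 : ℝ) ≤ n := by exact_mod_cast Nat.one_le_iff_ne_zero.2 hn
  have hmem : ∀ θ, θ ∈ D ↔ α * ‖θ - θ₀‖ ≤ ν * ‖f θ₀ - y‖ := fun θ => by
    rw [hD, mem_closedBall_iff_norm, ← mul_div_assoc, le_div_iff₀ hα, mul_comm]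
  have hconv : Convex ℝ D := hD ▸ convex_closedBall _ _
  have hθ₀ : θ₀ ∈ D := (hmem θ₀).2 (by simp; positivity)
  have hsmall : η * (ν * β ^ 2 * B ^ 2) ≤ α ^ 2 := by
    rcases hdev with ⟨-, h⟩ | ⟨L, hL, -, h⟩
    · exact h
    · have : 0 ≤ η * (ν * β * B * L * ‖f θ₀ - y‖) := by positivity
      linarith
  have hηβB : η * (β ^ 2 * B ^ 2) ≤ α ^ 2 / 4 := by
    have : 0 ≤ η * (β ^ 2 * B ^ 2) := by positivity
    nlinarith
  have hηB : η * B ^ 2 ≤ 1 / 4 := by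
    have h1 : α ^ 2 ≤ β ^ 2 := pow_le_pow_left₀ hα.le hαβ 2
    have h2 : β ^ 2 * (η * B ^ 2) ≤ β ^ 2 * (1 / 4) := by linarith
    exact le_of_mul_le_mul_left h2 (by positivity)
  have hηβ : η * β ^ 2 ≤ 1 / 4 := by
    have h1 : α ^ 2 ≤ B ^ 2 := pow_le_pow_left₀ hα.le hαB 2
    have h2 : B ^ 2 * (η * β ^ 2) ≤ B ^ 2 * (1 / 4) := by linarith
    exact le_of_mul_le_mul_left h2 (by positivity)
  have hηα : η * α ^ 2 / n ≤ 1 := by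
    rw [div_le_one (by positivity)]
    have := mul_le_mul_of_nonneg_left (pow_le_pow_left₀ hα.le hαβ 2) hη.le
    linarith
  have hvar : ∀ θ, α * ‖θ - θ₀‖ ≤ ν * ‖f θ₀ - y‖ →
      η * ∑ i, ‖sampleGradient f y θ i‖ ^ 2 ≤ ‖f θ - y‖ ^ 2 / 4 := fun θ hθ => by
    have h1 : ∑ i, ‖sampleGradient f y θ i‖ ^ 2 ≤ B ^ 2 * ‖f θ - y‖ ^ 2 :=
      sum_norm_sampleGradient_sq_le fun i =>
        pow_le_pow_left₀ (norm_nonneg _) (hrow θ ((hmem θ).2 hθ) i) 2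
    have h2 := mul_le_mul_of_nonneg_left h1 hη.le
    have h3 := mul_le_mul_of_nonneg_right hηB (sq_nonneg ‖f θ - y‖)
    linarith
  -- The cases where the squared residual is itself the Lyapunov function, so that no factor is
  -- lost.
  have direct : (∀ θ ∈ D, 11 / 4 * ‖f θ - y‖ < ν * ‖f θ₀ - y‖ →
      LyapunovDecrease f y η α (residualSqOn f y D) θ) →
      ∃ E : Set Ω, MeasurableSet E ∧ 1 - 4 / ν ≤ P.real E ∧
      (∀ ω ∈ E, ∀ τ, sgd f y η θ₀ (fun t => γ t ω) τ ∈ D) ∧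
      ∀ τ, ∫ ω, E.indicator (fun ω => ‖f (sgd f y η θ₀ (fun t => γ t ω) τ) - y‖ ^ 2) ω ∂P
          ≤ (1 - 1 / 2 * (η * α ^ 2 / n)) ^ τ * ‖f θ₀ - y‖ ^ 2 := by
    intro hdec
    obtain ⟨E, hEm, hEP, hED, hEi⟩ := hγ.exists_event_of_lyapunov hn hη hα hν0 hηα h0
      (Φ := residualSqOn f y D) (residualSqOn_nonneg f y D) (residualSqOn_of_mem hθ₀).le hvar
      (fun θ hθ => by
        have hθD : θ ∈ D := (hmem θ).2 (by
          have := Real.sqrt_nonneg (residualSqOn f y D θ)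
          linarith)
        refine hdec θ hθD ?_
        rw [residualSqOn_of_mem hθD, Real.sqrt_sq (norm_nonneg _)] at hθ
        have : 0 ≤ α * ‖θ - θ₀‖ := by positivity
        linarith)
      (fun θ hθ => (residualSqOn_of_mem ((hmem θ).2 hθ)).ge)
    refine ⟨E, hEm, le_trans ?_ hEP, fun ω hω τ => (hmem _).2 (hED ω hω τ), fun τ =>
      (hEi τ).trans (mul_le_mul_of_nonneg_right (pow_le_pow_left₀ (by linarith) ?_ τ)
        (sq_nonneg _))⟩
    · have : 45 / 4 / ν ^ 2 ≤ 4 / ν := by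
        rw [div_le_div_iff₀ (by positivity) hν0]
        nlinarith
      linarith
    · have : 0 ≤ η * α ^ 2 / n := by positivity
      linarith
  rcases hdev with ⟨hdev, -⟩ | ⟨L, hL, hdev, hηL⟩
  -- With one sample there is no randomness from which to build the auxiliary event, but the descent
  -- is then deterministic.
  · rcases Nat.lt_or_ge n 2 with hn2 | hn2
    · obtain rfl : n = 1 := by omega
      exact direct fun θ hθ _ =>
        lyapunovDecrease_of_one_sample hconv hα hαβ hη.le hf hβ hlow hdev hθ hηβ
    · have hcomp : IsCompact D := hD ▸ isCompact_closedBall _ _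
      choose π hπD hπ using
        exists_isMinOn_shadowCost y (jacobian f θ₀) (ν * β ^ 2 / 4) hcomp ⟨θ₀, hθ₀⟩ hf
      have hδ0 : 0 ≤ (1 - 1 / 2) * α ^ 2 / β :=
        div_nonneg (mul_nonneg (by norm_num) (sq_nonneg α)) hβ0.le
      have hδ : (1 - 1 / 2) * α ^ 2 / β ≤ β / 2 := by
        rw [div_le_iff₀ hβ0]
        nlinarith
      obtain ⟨E, hEm, hEP, hED, hEi⟩ := hγ.exists_event_of_lyapunov_of_le_mul hn2 hη hα hν hηα h0
        (Φ := fun θ => shadowCost f y (jacobian f θ₀) (ν * β ^ 2 / 4) θ (π θ))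
        (fun θ => by rw [shadowCost]; positivity)
        ((hπ θ₀ hθ₀).trans (shadowCost_self f y _ _ θ₀).le) hvar
        (fun θ hθ => by
          -- Since K ≥ α², the minimizer is within √Φ/α of θ. The margin (11/4)√Φ in the region then
          -- puts it in the interior of D, as stationarity requires.
          have hs : α * ‖θ - π θ‖
              ≤ √(shadowCost f y (jacobian f θ₀) (ν * β ^ 2 / 4) θ (π θ)) := by
            refine Real.le_sqrt_of_sq_le ?_
            rw [shadowCost, mul_pow]
            have h1 : α ^ 2 ≤ ν * β ^ 2 / 4 := by nlinarith
            have h2 := mul_le_mul_of_nonneg_right h1 (sq_nonneg ‖θ - π θ‖)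
            have h3 := sq_nonneg ‖jacobian f θ₀ (θ - π θ) + (f (π θ) - y)‖
            linarith
          have hs0 := Real.sqrt_nonneg
            (shadowCost f y (jacobian f θ₀) (ν * β ^ 2 / 4) θ (π θ))
          refine lyapunovDecrease_shadow hn hconv hα hαβ hν hη.le hf hβ hlow hrow hdev hsmall hθ₀
            hπD hπ ((hmem θ).2 (by linarith)) ?_
          rw [hD]
          refine Filter.mem_of_superset (Metric.isOpen_ball.mem_nhds ?_)
            Metric.ball_subset_closedBall
          rw [mem_ball_iff_norm, ← mul_div_assoc, lt_div_iff₀ hα, mul_comm]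
          have h1 : ‖π θ - θ₀‖ ≤ ‖θ - π θ‖ + ‖θ - θ₀‖ := by
            rw [norm_sub_rev θ (π θ)]
            exact norm_sub_le_norm_sub_add_norm_sub _ _ _
          have h2 := mul_le_mul_of_nonneg_left h1 hα.le
          linarith)
        (fun θ hθ => norm_residual_sq_le_shadowCost hconv hf (fun z hz => hdev θ₀ hθ₀ z hz) hδ0 hδ
          hν0 ((hmem θ).2 hθ) (hπD θ))
      exact ⟨E, hEm, hEP, fun ω hω τ => (hmem _).2 (hED ω hω τ), hEi⟩
  · refine direct fun θ hθ hθr =>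
      lyapunovDecrease_of_smooth hn hconv hα hβ0 hL hη.le hf hβ hlow hrow hdev hθ ?_
    -- The region gives ‖r‖ < (4/11)ν‖f(θ₀) − y‖, so 2‖r‖ accounts for the 8/11; for the other term
    -- 1/ν ≤ 1/4 suffices.
    have h1 : η * (2 * L * (β * B)) * ‖f θ - y‖
        ≤ η * (2 * L * (β * B)) * (4 / 11 * (ν * ‖f θ₀ - y‖)) :=
      mul_le_mul_of_nonneg_left (by linarith) (by positivity)
    have h2 : 0 ≤ η * (β ^ 2 * B ^ 2) := by positivity
    nlinarith

end Main

theorem theorem3 {p n : ℕ} (f : RVec p → RVec n) (y : RVec n) (θ₀ : RVec p)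
    (α β B ν η : ℝ) (hα : 0 < α) (hν : 3 ≤ ν) (hη : 0 ≤ η)
    (D : Set (RVec p)) (hD : D = Metric.closedBall θ₀ (ν * (‖f θ₀ - y‖ / α)))
    (hspec : JacobianSpectrum f D α β)
    (hrow : ∀ θ ∈ D, ∀ i, ‖jacobianRow f i θ‖ ≤ B)
    (hdev :
      (JacobianBoundedDeviation f D α β (1 / 2) ∧ η ≤ α ^ 2 / (ν * β ^ 2 * B ^ 2)) ∨
      (∃ L : ℝ, JacobianSmoothDeviation f D L ∧
        η ≤ α ^ 2 / (ν * β ^ 2 * B ^ 2 + ν * β * B * L * ‖f θ₀ - y‖)))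
    {Ω : Type*} [MeasurableSpace Ω] (P : Measure Ω) [IsProbabilityMeasure P]
    (γ : ℕ → Ω → Fin n) (hγ : IsUniformSampling P γ) :
    ∃ E : Set Ω, MeasurableSet E ∧
      1 - 4 / ν * (β / α) ^ (1 / (p : ℝ)) ≤ P.real E ∧
      (∀ ω ∈ E, ∀ τ, sgd f y η θ₀ (fun t => γ t ω) τ ∈ D) ∧
      ∀ τ : ℕ,
        Integrable (E.indicator fun ω => ‖f (sgd f y η θ₀ (fun t => γ t ω) τ) - y‖ ^ 2) P ∧
        ∫ ω, E.indicator (fun ω => ‖f (sgd f y η θ₀ (fun t => γ t ω) τ) - y‖ ^ 2) ω ∂P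
          ≤ (1 - η * α ^ 2 / (2 * n)) ^ τ * ‖f θ₀ - y‖ ^ 2 := by
  obtain ⟨ω₀⟩ : Nonempty Ω := nonempty_of_isProbabilityMeasure P
  set i₀ : Fin n := γ 0 ω₀
  have hn : n ≠ 0 := fun h => (h ▸ i₀).elim0
  have hν0 : 0 < ν := by linarith
  have hθ₀ : θ₀ ∈ D := by
    rw [hD]
    exact Metric.mem_closedBall_self (by positivity)
  have hf : ∀ ϑ ∈ D, DifferentiableAt ℝ f ϑ := fun ϑ h => (hspec ϑ h).1
  have hβ : ∀ ϑ ∈ D, ‖jacobian f ϑ‖ ≤ β := fun ϑ h => (hspec ϑ h).2.2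
  have hlow : ∀ ϑ ∈ D, ∀ w, α * ‖w‖ ≤ ‖ContinuousLinearMap.adjoint (jacobian f ϑ) w‖ :=
    fun ϑ h w => (mul_le_mul_of_nonneg_right (hspec ϑ h).2.1 (norm_nonneg w)).trans
      (sigmaMin_mul_norm_le _ w)
  have hrow₀ : α ≤ ‖jacobianRow f i₀ θ₀‖ := by
    rw [jacobianRow_eq_adjoint (hf θ₀ hθ₀)]
    simpa using hlow θ₀ hθ₀ (EuclideanSpace.single i₀ 1)
  have hαB : α ≤ B := hrow₀.trans (hrow θ₀ hθ₀ i₀)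
  have hαβ : α ≤ β := by
    refine hrow₀.trans ?_
    rw [jacobianRow_eq_adjoint (hf θ₀ hθ₀)]
    simpa using norm_adjoint_apply_le (hβ θ₀ hθ₀) (EuclideanSpace.single i₀ (1 : ℝ))
  have hB0 : 0 < B := hα.trans_le hαB
  have hβ0 : 0 < β := hα.trans_le hαβ
  have hratio : 1 - 4 / ν * (β / α) ^ (1 / (p : ℝ)) ≤ 1 - 4 / ν := by
    have h1 : 1 ≤ (β / α) ^ (1 / (p : ℝ)) :=
      Real.one_le_rpow ((one_le_div hα).2 hαβ) (by positivity)
    have h2 := mul_le_mul_of_nonneg_left h1 (by positivity : 0 ≤ 4 / ν)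
    linarith
  have hrate : 1 - η * α ^ 2 / (2 * n) = 1 - 1 / 2 * (η * α ^ 2 / n) := by
    field_simp
  have hint : ∀ E : Set Ω, MeasurableSet E → ∀ τ, Integrable
      (E.indicator fun ω => ‖f (sgd f y η θ₀ (fun t => γ t ω) τ) - y‖ ^ 2) P :=
    fun E hE τ => hγ.integrable_indicator_sgd f y η θ₀ (fun θ => ‖f θ - y‖ ^ 2) hE τ
  -- In these cases the iterates never move.
  by_cases htriv : η = 0 ∨ f θ₀ - y = 0
  · have hconst : ∀ g τ, sgd f y η θ₀ g τ = θ₀ := sgd_eq_of_smul_sampleGradient_eq_zero fun i => by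
      rcases htriv with h | h
      · rw [h, zero_smul]
      · have : f θ₀ i - y i = 0 := congrArg (fun v : RVec n => v i) h
        rw [sampleGradient, this, zero_smul, smul_zero]
    refine ⟨Set.univ, .univ, ?_, fun ω _ τ => by rwa [hconst], fun τ =>
      ⟨hint _ .univ τ, ?_⟩⟩
    · rw [probReal_univ]
      have : 0 ≤ 4 / ν := by positivity
      linarith
    · simp only [hconst]
      rcases htriv with h | h <;> simp [h]
  push Not at htriv
  have hη' : 0 < η := lt_of_le_of_ne hη htriv.1.symm
  have h0 : 0 < ‖f θ₀ - y‖ := norm_pos_iff.2 htriv.2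
  have hdev' : (JacobianBoundedDeviation f D α β (1 / 2) ∧ η * (ν * β ^ 2 * B ^ 2) ≤ α ^ 2) ∨
      (∃ L : ℝ, 0 ≤ L ∧ JacobianSmoothDeviation f D L ∧
        η * (ν * β ^ 2 * B ^ 2 + ν * β * B * L * ‖f θ₀ - y‖) ≤ α ^ 2) := by
    rcases hdev with ⟨h, hle⟩ | ⟨L, h, hle⟩
    · exact Or.inl ⟨h, (le_div_iff₀ (by positivity)).1 hle⟩
    · have hL : 0 ≤ L := by
        rw [hD] at h
        refine h.nonneg (v := jacobianRow f i₀ θ₀) (by positivity) fun hv => ?_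
        rw [hv, norm_zero] at hrow₀
        linarith
      exact Or.inr ⟨L, hL, h, (le_div_iff₀ (by positivity)).1 hle⟩
  -- Here 4/ν ≥ 1, so the empty event suffices and only the sign of the rate has to be checked.
  by_cases hν4 : ν ≤ 4
  · refine ⟨∅, .empty, ?_, fun ω hω => hω.elim, fun τ => ⟨hint _ .empty τ, ?_⟩⟩
    · have : 1 ≤ 4 / ν := (one_le_div hν0).2 hν4
      rw [measureReal_empty]
      linarith
    · have hsmall : η * (ν * β ^ 2 * B ^ 2) ≤ α ^ 2 := by
        rcases hdev' with ⟨-, h⟩ | ⟨L, hL, -, h⟩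
        · exact h
        · have : 0 ≤ η * (ν * β * B * L * ‖f θ₀ - y‖) := by positivity
          linarith
      have h1 : α ^ 2 * α ^ 2 ≤ β ^ 2 * B ^ 2 :=
        mul_le_mul (pow_le_pow_left₀ hα.le hαβ 2) (pow_le_pow_left₀ hα.le hαB 2) (by positivity)
          (by positivity)
      have h2 : α ^ 2 * (η * α ^ 2) ≤ α ^ 2 * 1 := by
        have h3 : 0 ≤ η * (β ^ 2 * B ^ 2) := by positivity
        nlinarith [mul_le_mul_of_nonneg_left h1 hη]
      have h4 : η * α ^ 2 ≤ 1 := le_of_mul_le_mul_left h2 (by positivity)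
      have h5 : η * α ^ 2 / n ≤ 1 := by
        rw [div_le_one (by positivity)]
        have : (1 : ℝ) ≤ n := by exact_mod_cast Nat.one_le_iff_ne_zero.2 hn
        linarith
      have h6 : 0 ≤ 1 - η * α ^ 2 / (2 * n) := by
        rw [hrate]
        linarith
      simp only [Set.indicator_empty, integral_zero]
      positivity
  · obtain ⟨E, hEm, hEP, hED, hEi⟩ := hγ.exists_event_sgd hn hα hαβ hαB (le_of_not_ge hν4) hη' h0 hD
      hf hβ hlow hrow hdev'
    exact ⟨E, hEm, hratio.trans hEP, hED, fun τ => ⟨hint E hEm τ, hrate ▸ hEi τ⟩⟩
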